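/- Throughout, $\log=\log_2$, inputs are $x\in\{1,2\}$, outputs are $a\in\{\pm1\}$ (identified with bits), vector inequalities are componentwise, and all random variables are discrete, with $\mathrm{TV}(\mu,\nu)=\frac12\sum_z|\mu(z)-\nu(z)|$. **Quantum behaviours.** $\mathcal Q\subset\mathbb R^4$ is the convex hull of the set of all $(\vec E,\vec\omega)=(E_1,E_2,\omega_1,\omega_2)$ for which there are a Hilbert space, two states (density operators) $\rho_1,\rho_2$, an observable $-1\le M\le 1$ and an energy observable $O$ (with an orthonormal eigenbasis, non-degenerate lowest eigenvalue $0$ and all other eigenvalues at least $1$) with $\mathrm{Tr}[\rho_xM]=E_x$ and $\mathrm{Tr}[\rho_xO]\le\omega_x$ for $x=1,2$. Put $\mathcal Q_{\vec\omega_{\rm pk}}=\{(\vec E,\vec\omega)\in\mathcal Q:\vec\omega\le\vec\omega_{\rm pk}\}$. **Protocol arguments.** Let $n\ge1$; let $p(x)>0$ be an input distribution on $\{1,2\}$; let $\vec 0\le\vec\omega_{\rm avg}\le\vec\omega_{\rm pk}\le\vec 1$; let $\epsilon_\omega\ge0$, $\epsilon_t,\epsilon_m,\epsilon_{Ext}>0$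 and $\epsilon=\epsilon_t+\epsilon_m+\epsilon_{Ext}+\epsilon_\omega$. Let $(\vec\alpha,\vec\beta,\vec\gamma)\in(\mathbb R^2)^3$ be a trade-off function, i.e. $\vec\gamma\le0$ and $$\alpha_1+\alpha_2+\vec\beta\cdot\vec E+\vec\gamma\cdot\vec\omega\le H(\vec E):=-\sum_{a,x}p(x)\tfrac{1+aE_x}{2}\log\tfrac{1+aE_x}{2}\quad\text{for all }(\vec E,\vec\omega)\in\mathcal Q_{\vec\omega_{\rm pk}}.$$ Put $\xi(a,x)=\frac1{p(x)}(\alpha_x+a\beta_x)$, $\xi^+=\max\xi$, $\xi^-=\min\xi$, $\bar\gamma=\gamma_1+\gamma_2$, $|A|=2$, $$V=\max\{(\xi^++\bar\gamma)^2,(\xi^-+\bar\gamma)^2\}+2\max\{-\log|A|\,(\bar\gamma+\xi^-),0\}+\tfrac{4|A|}{e^2}(\log_2e)^2,$$ $$t=\sqrt{2V}\sqrt{\tfrac{\log(1/\epsilon_t)}{n}}+\tfrac{\xi^+}{3}\tfrac{\log(1/\epsilon_t)}{n},$$ and assume that the error term satisfies $t\ge0$ (automatic if $\xi^+\ge0$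 and $\epsilon_t\le1$). Let $r\in\mathbb R$ be a threshold with $r-t\le1$, put $\sigma_h=n(r-t)-\log(1/\epsilon_m)$, and let $\mathcal E:\{0,1\}^n\times\{0,1\}^l\to\{0,1\}^\sigma$ be a strong extractor with parameters $(n,l,\sigma_h,\sigma,\epsilon_{Ext})$: for every $A$ on $\{0,1\}^n$ with $\max_a\Pr(A=a)\le2^{-\sigma_h}$ and an independent uniform seed $S$, the law of $(\mathcal E(A,S),S)$ is within total variation distance $\epsilon_{Ext}$ of uniform. **Device assumptions.** Let $\mu$ be the distribution of $(A^n,X^n,\Lambda)$ with $A^n\in\{\pm1\}^n$, $X^n\in\{1,2\}^n$ and $\Lambda$ the adversary's information, and let $W_i=(A^{i-1},X^{i-1})$. Assume that there are functions $\vec E_i(W_i,\Lambda)$, $\vec\omega_i(W_i,\Lambda)$ such that, for all $i=1,\dots,n$ and all values of $(W_i,\Lambda)$ of positive probability: $\mu_{X_i|W_i\Lambda}(x)=p(x)$; $\mu_{A_i|X_iW_i\Lambda}(a|x)=\frac12(1+aE_{x,i}(W_i,\Lambda))$; $(\vec E_i(W_i,\Lambda),\vec\omega_i(W_i,\Lambda))\in\mathcal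 Q$; and $\vec\omega_i(W_i,\Lambda)\le\vec\omega_{\rm pk}$. Assume moreover that $\Pr\big(\frac1n\sum_{i=1}^n\vec\omega_i(W_i,\Lambda)\le\vec\omega_{\rm avg}\big)\ge1-\epsilon_\omega$. **Theorem.** Let $\mathrm{Pass}$ be the event $\frac1n\sum_i\xi(A_i,X_i)+\vec\gamma\cdot\vec\omega_{\rm avg}\ge r$, let $\kappa=\Pr(\mathrm{Pass})$, and let $K=\mathcal E(A^n,S)$ with $S$ uniform on $\{0,1\}^l$ and independent of $(A^n,X^n,\Lambda)$. If $\kappa>0$, then $$\mathrm{TV}\big(\mu_{[KSX^n\Lambda|\mathrm{Pass}]},\ \mathrm{Unif}_{KS}\otimes\mu_{[X^n\Lambda|\mathrm{Pass}]}\big)\le\epsilon_{Ext}+\frac{\epsilon_\omega+\epsilon_t+\epsilon_m}{\kappa}\le\frac{\epsilon}{\kappa}.$$ In particular, the protocol is $\epsilon$-sound: $$\Pr(\mathrm{Pass})\cdot\mathrm{TV}\big(\mu_{[KSX^n\Lambda|\mathrm{Pass}]},\ \mathrm{Unif}_{KS}\otimes\mu_{[X^n\Lambda|\mathrm{Pass}]}\big)\le\epsilon,$$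 where the left side is read as $0$ if $\kappa=0$. -/

import Mathlib

open scoped InnerProductSpace

noncomputable section

namespace EnergyQRNG

/-! ### Discrete probability -/

/-- Probability of an event under a discrete distribution. -/
def prob {Ω : Type*} (μ : PMF Ω) (S : Set Ω) : ℝ := (μ.toOuterMeasure S).toReal

/-- Conditional probability `Pr(S | T)`; meaningful when `Pr(T) ≠ 0`. -/
def condProb {Ω : Type*} (μ : PMF Ω) (S T : Set Ω) : ℝ := prob μ (S ∩ T) / prob μ T

/-- Total variation distance of two discrete distributions given by their mass functions. -/
def TV {Ω : Type*} (f g : Ω → ℝ) : ℝ := (1 / 2) * ∑' z, |f z - g z|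

/-- Bit strings of length `k`. -/
abbrev Bits (k : ℕ) : Type := Fin k → Bool

/-- The mass of each point under the uniform distribution on a finite type. -/
def unifMass (α : Type*) [Fintype α] : ℝ := 1 / (Fintype.card α : ℝ)

/-- The joint law of a random variable with distribution `μ` and an independent uniform seed of
`l` bits. -/
def withSeed {Ω : Type*} (μ : PMF Ω) (l : ℕ) : PMF (Ω × Bits l) :=
  μ.bind fun o => (PMF.uniformOfFintype (Bits l)).map fun s => (o, s)

/-- Strong extractor with parameters `(n, l, k, m, ε)`: for every source on `n` bits of
min-entropy at least `k`, the pair (output, seed) is `ε`-close to uniform. -/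
def IsStrongExtractor {n l m : ℕ} (Ext : Bits n → Bits l → Bits m) (k ε : ℝ) : Prop :=
  ∀ μ : PMF (Bits n), (∀ a, prob μ {a} ≤ (2 : ℝ) ^ (-k)) →
    TV (fun z : Bits m × Bits l => prob (withSeed μ l) {q | Ext q.1 q.2 = z.1 ∧ q.2 = z.2})
      (fun _ => unifMass (Bits m × Bits l)) ≤ ε

/-! ### Quantum behaviours

The two inputs are indexed by `Fin 2`. Outputs are bits; `true` stands for `+1` and `false`
for `-1`. -/

/-- The numerical value of an output. -/
def sgn (a : Bool) : ℝ := if a then 1 else -1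

/-- A quantum representation of the behaviour `(E, ω)` on the Hilbert space `H`, without shared
randomness. The energy observable, which may be unbounded, is given by an orthonormal eigenbasis
`b` with eigenvalues `e`: `O (b j) = e j • b j`. Traces are computed in this basis. -/
structure QuantumRep (H : Type) [NormedAddCommGroup H] [InnerProductSpace ℂ H]
    [CompleteSpace H] (E ω : Fin 2 → ℝ) where
  /-- index set of the eigenbasis of the energy observable -/
  ι : Type
  /-- eigenbasis of the energy observable -/
  b : HilbertBasis ι ℂ H
  /-- eigenvalues of the energy observable -/
  e : ι → ℝ
  /-- the vacuum -/
  vac : ι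
  /-- the states sent by the source -/
  ρ : Fin 2 → H →L[ℂ] H
  /-- the measured observable -/
  M : H →L[ℂ] H
  energy_vac : e vac = 0
  energy_gap : ∀ j, j ≠ vac → 1 ≤ e j
  state_pos : ∀ x, (ρ x).IsPositive
  state_trace : ∀ x, HasSum (fun j => ⟪b j, ρ x (b j)⟫_ℂ) 1
  neg_one_le_M : (M + 1).IsPositive
  M_le_one : (1 - M).IsPositive
  corr : ∀ x, HasSum (fun j => ⟪b j, ρ x (M (b j))⟫_ℂ) (E x : ℂ)
  energy_summable : ∀ x, Summable fun j => e j * (⟪b j, ρ x (b j)⟫_ℂ).re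
  energy_le : ∀ x, ∑' j, e j * (⟪b j, ρ x (b j)⟫_ℂ).re ≤ ω x

/-- The set of quantum behaviours: convex combinations of behaviours with a quantum
representation. -/
def Q : Set ((Fin 2 → ℝ) × (Fin 2 → ℝ)) :=
  convexHull ℝ {B | ∃ (H : Type) (_ : NormedAddCommGroup H) (_ : InnerProductSpace ℂ H)
    (_ : CompleteSpace H), Nonempty (QuantumRep H B.1 B.2)}

/-- Quantum behaviours with energies bounded by `ωpk`. -/
def Qpk (ωpk : Fin 2 → ℝ) : Set ((Fin 2 → ℝ) × (Fin 2 → ℝ)) := {B | B ∈ Q ∧ B.2 ≤ ωpk}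

/-- Conditional Shannon entropy (in bits) of the output given the input, for the correlations
`E` and the input distribution `p`. -/
def H (p E : Fin 2 → ℝ) : ℝ :=
  -∑ a : Bool, ∑ x, p x * ((1 + sgn a * E x) / 2) * Real.logb 2 ((1 + sgn a * E x) / 2)

/-- Trade-off functions with max-peak energies `ωpk`. -/
def IsTradeoff (p ωpk α β γ : Fin 2 → ℝ) : Prop :=
  γ ≤ 0 ∧ ∀ B ∈ Qpk ωpk,
    ∑ x, α x + ∑ x, β x * B.1 x + ∑ x, γ x * B.2 x ≤ H p B.1

/-! ### The device used `n` times -/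

/-- Values of `(Aⁿ, Xⁿ, Λ)`. -/
abbrev Run (n : ℕ) (L : Type*) : Type _ := Bits n × (Fin n → Fin 2) × L

/-- The entries of a sequence strictly before round `i`. -/
def past {n : ℕ} {α : Type*} (i : Fin n) (u : Fin n → α) : Fin i → α :=
  fun j => u (j.castLE i.isLt.le)

/-- A pair of real numbers for each round `i`, depending on the past outputs and inputs
`W_i = (A^{i-1}, X^{i-1})` and on the adversary's information. -/
abbrev RoundFun (n : ℕ) (L : Type*) : Type _ :=
  (i : Fin n) → (Fin i → Bool) → (Fin i → Fin 2) → L → Fin 2 → ℝ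

/-- The event that `W_i = (a, x)` and `Λ = lam`. -/
def pastEvent {n : ℕ} {L : Type*} (i : Fin n) (a : Fin i → Bool) (x : Fin i → Fin 2) (lam : L) :
    Set (Run n L) :=
  {o | past i o.1 = a ∧ past i o.2.1 = x ∧ o.2.2 = lam}

/-- The assumptions on the distribution `μ` of `(Aⁿ, Xⁿ, Λ)`, with correlations `E` and
energies `ω` of the individual rounds. -/
structure DeviceAssumptions {n : ℕ} {L : Type*} (μ : PMF (Run n L)) (E ω : RoundFun n L)
    (p ωpk ωavg : Fin 2 → ℝ) (εω : ℝ) : Prop where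
  /-- inputs are drawn from `p`, independently of the past and of `Λ` -/
  input : ∀ i a x lam, prob μ (pastEvent i a x lam) ≠ 0 → ∀ x₀,
    condProb μ {o | o.2.1 i = x₀} (pastEvent i a x lam) = p x₀
  /-- the output of round `i` has correlations `E i` -/
  output : ∀ i a x lam x₀, prob μ ({o | o.2.1 i = x₀} ∩ pastEvent i a x lam) ≠ 0 → ∀ a₀,
    condProb μ {o | o.1 i = a₀} ({o | o.2.1 i = x₀} ∩ pastEvent i a x lam)
      = (1 + sgn a₀ * E i a x lam x₀) / 2
  /-- each round is a valid quantum behaviour -/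
  quantum : ∀ i a x lam, prob μ (pastEvent i a x lam) ≠ 0 → (E i a x lam, ω i a x lam) ∈ Q
  /-- max-peak assumption -/
  max_peak : ∀ i a x lam, prob μ (pastEvent i a x lam) ≠ 0 → ω i a x lam ≤ ωpk
  /-- max-average assumption -/
  max_avg : 1 - εω ≤ prob μ {o | ∀ x₀,
    (1 / (n : ℝ)) * ∑ i, ω i (past i o.1) (past i o.2.1) o.2.2 x₀ ≤ ωavg x₀}

/-! ### The protocol -/

/-- Arguments of the protocol. -/
structure Args where
  /-- number of rounds -/
  n : ℕ
  /-- length of the seed -/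
  l : ℕ
  /-- length of the final string -/
  σ : ℕ
  /-- input distribution -/
  p : Fin 2 → ℝ
  /-- max-peak energies -/
  ωpk : Fin 2 → ℝ
  /-- max-average energies -/
  ωavg : Fin 2 → ℝ
  /-- failure probability of the max-average assumption -/
  εω : ℝ
  /-- security parameter of the error term -/
  εt : ℝ
  /-- security parameter of the min-entropy -/
  εm : ℝ
  /-- security parameter of the extractor -/
  εExt : ℝ
  /-- trade-off function, constant part -/
  α : Fin 2 → ℝ
  /-- trade-off function, coefficients of the correlations -/
  β : Fin 2 → ℝ
  /-- trade-off function, coefficients of the energies -/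
  γ : Fin 2 → ℝ
  /-- threshold of the test -/
  r : ℝ
  /-- extractor -/
  ext : Bits n → Bits l → Bits σ

namespace Args

variable (P : Args)

/-- `ε = ε_t + ε_m + ε_Ext + ε_ω` -/
def ε : ℝ := P.εt + P.εm + P.εExt + P.εω

/-- The estimator `ξ(a, x)`. -/
def ξ (a : Bool) (x : Fin 2) : ℝ := 1 / P.p x * (P.α x + sgn a * P.β x)

/-- `ξ⁺` -/
def ξmax : ℝ := ⨆ z : Bool × Fin 2, P.ξ z.1 z.2

/-- `ξ⁻` -/
def ξmin : ℝ := ⨅ z : Bool × Fin 2, P.ξ z.1 z.2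

/-- `γ̄ = ∑ₓ γₓ` -/
def γbar : ℝ := ∑ x, P.γ x

/-- The constant `V`; the cardinality of the output alphabet is that of `Bool`. -/
def V : ℝ :=
  max ((P.ξmax + P.γbar) ^ 2) ((P.ξmin + P.γbar) ^ 2)
    + 2 * max (-(Real.logb 2 (Fintype.card Bool) * (P.γbar + P.ξmin))) 0
    + 4 * (Fintype.card Bool : ℝ) / Real.exp 1 ^ 2 * Real.logb 2 (Real.exp 1) ^ 2

/-- The error term `t`. -/
def t : ℝ :=
  √(2 * P.V) * √(Real.logb 2 (1 / P.εt) / P.n) + P.ξmax / 3 * (Real.logb 2 (1 / P.εt) / P.n)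

/-- The bound `σ_h` on the min-entropy. -/
def σh : ℝ := P.n * (P.r - √(2 * P.V) * √(Real.logb 2 (1 / P.εt) / P.n)
  - P.ξmax / 3 * (Real.logb 2 (1 / P.εt) / P.n) - Real.logb 2 (1 / P.εm) / P.n)

/-- Validity of the arguments of the protocol. -/
structure Valid : Prop where
  n_pos : 0 < P.n
  p_pos : ∀ x, 0 < P.p x
  p_sum : ∑ x, P.p x = 1
  avg_nonneg : 0 ≤ P.ωavg
  avg_le_pk : P.ωavg ≤ P.ωpk
  pk_le_one : P.ωpk ≤ 1
  εω_nonneg : 0 ≤ P.εω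
  εt_pos : 0 < P.εt
  εm_pos : 0 < P.εm
  εExt_pos : 0 < P.εExt
  tradeoff : IsTradeoff P.p P.ωpk P.α P.β P.γ
  threshold : P.r - P.t ≤ 1
  extractor : IsStrongExtractor P.ext P.σh P.εExt

/-- The event that the test is passed. -/
def pass (L : Type*) : Set (Run P.n L) :=
  {o | P.r ≤ (1 / (P.n : ℝ)) * ∑ i, P.ξ (o.1 i) (o.2.1 i) + ∑ x, P.γ x * P.ωavg x}

variable {L : Type*} (μ : PMF (Run P.n L))

/-- `κ = Pr(Pass)` -/
def κ : ℝ := prob μ (P.pass L)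

/-- Mass function of `(K, S, Xⁿ, Λ)` conditioned on `Pass`, where `K = ext(Aⁿ, S)` and the seed
`S` is uniform and independent of `(Aⁿ, Xⁿ, Λ)`. -/
def realMass (z : Bits P.σ × Bits P.l × (Fin P.n → Fin 2) × L) : ℝ :=
  condProb (withSeed μ P.l)
    {q | P.ext q.1.1 q.2 = z.1 ∧ q.2 = z.2.1 ∧ q.1.2 = z.2.2}
    {q | q.1 ∈ P.pass L}

/-- Mass function of the product of the uniform distribution of `(K, S)` with the distribution
of `(Xⁿ, Λ)` conditioned on `Pass`. -/
def idealMass (z : Bits P.σ × Bits P.l × (Fin P.n → Fin 2) × L) : ℝ :=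
  unifMass (Bits P.σ × Bits P.l) * condProb μ {o | o.2 = z.2.2} (P.pass L)

end Args

end EnergyQRNG

end

/-! Give round `i` the score `ξ(A_i, X_i) + γ·ω_i + log q_i`, where `q_i` is the conditional
probability of the output that occurred, given its input, the past and `Λ`. The trade-off inequality
makes its conditional mean at most 0 (`sum_score_nonpos`). The score is at most `ξ⁺`, because `γ ≤ 0
≤ ω_i` and `log q_i ≤ 0`, but it is unbounded below; its conditional second moment is at most `V`
(`second_moment_le`). A one-sided Bernstein inequality for adapted sums
(`sum_prod_past_indicator_le`) then keeps the total score below `n t` except with probability `ε_t`.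

On `Pass`, if the max-average bound holds and the total score is at most `n t`, then `∑ log q_i ≤ -n
(r - t)`. Since inputs are independent of the past, `∏ q_i` is the probability of `Aⁿ` given `(Xⁿ,
Λ)` (`mass_eq_outputProb_mul`), so these probabilities are at most `2^(-σ_h) ε_m`.

The extractor acts, for each value of `(Xⁿ, Λ)`, on the unnormalised weights restricted to `Pass`
and the good event (`extDist_le_of_part`). If their mass is at least `ε_m` times the probability of
that value, normalising leaves min-entropy `σ_h`; otherwise they are discarded, at a total cost of
at most `ε_m`. The bad event costs `ε_ω + ε_t`. Dividing by `κ` gives the bound. -/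

namespace EnergyQRNG

/-! ### Bernstein's inequality -/

/-- The difference of the two sides has a nondecreasing derivative that vanishes at 0, so its
minimum is its value 0 there. Monotonicity of the derivative reduces to `1 - y ≤ exp (-y)`. -/
theorem exp_mul_one_sub_div_three_le (y : ℝ) :
    (1 - y / 3) * (Real.exp y - 1 - y) ≤ y ^ 2 / 2 := by
  have hd2 : ∀ y : ℝ, HasDerivAt (fun y : ℝ => (y - 2) * Real.exp y + y + 2)
      ((y - 1) * Real.exp y + 1) y := fun y => by
    have := ((((hasDerivAt_id y).sub_const 2).mul (Real.hasDerivAt_exp y)).add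
      (hasDerivAt_id y)).add_const 2
    exact this.congr_deriv (by simp; ring)
  have hmono : Monotone (fun y : ℝ => (y - 2) * Real.exp y + y + 2) := by
    refine monotone_of_deriv_nonneg (fun y => (hd2 y).differentiableAt) fun y => ?_
    rw [(hd2 y).deriv]
    have h1 := Real.add_one_le_exp (-y)
    have h2 := Real.exp_pos y
    have h3 : Real.exp (-y) * Real.exp y = 1 := by rw [← Real.exp_add]; simp
    nlinarith
  have hd1 : ∀ y : ℝ, HasDerivAt
      (fun y : ℝ => y ^ 2 / 2 - (1 - y / 3) * (Real.exp y - 1 - y))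
      (((y - 2) * Real.exp y + y + 2) / 3) y := fun y => by
    have := (((hasDerivAt_id y).pow 2).div_const 2).sub
      ((((hasDerivAt_id y).div_const 3).const_sub 1).mul
        (((Real.hasDerivAt_exp y).sub_const 1).sub (hasDerivAt_id y)))
    exact this.congr_deriv (by simp; ring)
  have hc : Continuous (fun y : ℝ => y ^ 2 / 2 - (1 - y / 3) * (Real.exp y - 1 - y)) := by
    fun_prop
  suffices h : (fun y : ℝ => y ^ 2 / 2 - (1 - y / 3) * (Real.exp y - 1 - y)) 0
      ≤ (fun y : ℝ => y ^ 2 / 2 - (1 - y / 3) * (Real.exp y - 1 - y)) y by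
    simp at h; linarith
  rcases le_total 0 y with hy | hy
  · refine monotoneOn_of_deriv_nonneg (convex_Ici 0) hc.continuousOn
      (fun z _ => (hd1 z).differentiableAt.differentiableWithinAt) (fun z hz => ?_)
      (Set.mem_Ici.2 le_rfl) hy hy
    rw [(hd1 z).deriv]
    rw [interior_Ici] at hz
    have := hmono (le_of_lt hz)
    simp at this; linarith
  · refine antitoneOn_of_deriv_nonpos (convex_Iic 0) hc.continuousOn
      (fun z _ => (hd1 z).differentiableAt.differentiableWithinAt) (fun z hz => ?_)
      hy (Set.mem_Iic.2 le_rfl) hy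
    rw [(hd1 z).deriv]
    rw [interior_Iic] at hz
    have := hmono (le_of_lt hz)
    simp at this; linarith

/-- Only an upper bound on `y` is needed, because `exp y - 1 - y ≥ 0` lets `1 - y / 3` be lowered to
`1 - c / 3`. This matters for scores containing a logarithm. -/
theorem exp_le_one_add_add_sq_div {y c : ℝ} (hyc : y ≤ c) (hc : c < 3) :
    Real.exp y ≤ 1 + y + y ^ 2 / (2 * (1 - c / 3)) := by
  have h := exp_mul_one_sub_div_three_le y
  have h1 := Real.add_one_le_exp y
  have hpos : 0 < 1 - c / 3 := by linarith
  have h2 : (1 - c / 3) * (Real.exp y - 1 - y) ≤ y ^ 2 / 2 :=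
    (mul_le_mul_of_nonneg_right (by linarith) (by linarith)).trans h
  have h3 : Real.exp y - 1 - y ≤ y ^ 2 / (2 * (1 - c / 3)) := by
    rw [le_div_iff₀ (by positivity)]; linarith
  linarith

/-- Bernstein's bound on the moment generating function of a variable bounded above. -/
theorem sum_mul_exp_le {ι : Type*} [Fintype ι] {w U : ι → ℝ} {b s V : ℝ}
    (hw : ∀ i, 0 ≤ w i) (hw1 : ∑ i, w i = 1) (hU : ∀ i, U i ≤ b) (hs : 0 ≤ s)
    (hbs : s * b < 3) (hmean : ∑ i, w i * U i ≤ 0) (hvar : ∑ i, w i * U i ^ 2 ≤ V) :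
    ∑ i, w i * Real.exp (s * U i) ≤ Real.exp (s ^ 2 * V / (2 * (1 - s * b / 3))) := by
  have hpos : 0 < 1 - s * b / 3 := by linarith
  calc ∑ i, w i * Real.exp (s * U i)
      ≤ ∑ i, w i * (1 + s * U i + (s * U i) ^ 2 / (2 * (1 - s * b / 3))) :=
        Finset.sum_le_sum fun i _ => mul_le_mul_of_nonneg_left
          (exp_le_one_add_add_sq_div (mul_le_mul_of_nonneg_left (hU i) hs) hbs) (hw i)
    _ = ∑ i, w i + s * ∑ i, w i * U i
          + s ^ 2 / (2 * (1 - s * b / 3)) * ∑ i, w i * U i ^ 2 := by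
        rw [Finset.mul_sum, Finset.mul_sum, ← Finset.sum_add_distrib, ← Finset.sum_add_distrib]
        exact Finset.sum_congr rfl fun i _ => by ring
    _ ≤ 1 + 0 + s ^ 2 / (2 * (1 - s * b / 3)) * V := by
        gcongr
        · exact hw1.le
        · exact mul_nonpos_of_nonneg_of_nonpos hs hmean
    _ ≤ Real.exp (s ^ 2 * V / (2 * (1 - s * b / 3))) := by
        have := Real.add_one_le_exp (s ^ 2 * V / (2 * (1 - s * b / 3)))
        calc _ = s ^ 2 * V / (2 * (1 - s * b / 3)) + 1 := by ring
          _ ≤ _ := this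

/-- The optimal exponent in Bernstein's inequality. -/
theorem exists_bernstein_exponent {b V lam : ℝ} (hb : 0 ≤ b) (hV : 0 < V) (hlam : 0 ≤ lam) :
    ∃ s, 0 ≤ s ∧ s * b < 3 ∧
      s ^ 2 * V / (2 * (1 - s * b / 3)) - s * (√(2 * V) * √lam + b / 3 * lam) = -lam := by
  obtain ⟨u, hu, rfl⟩ : ∃ u, 0 ≤ u ∧ lam = u ^ 2 := ⟨√lam, by positivity, by simp [hlam]⟩
  obtain ⟨v, hv, hV2⟩ : ∃ v, 0 < v ∧ 2 * V = v ^ 2 :=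
    ⟨√(2 * V), by positivity, by rw [Real.sq_sqrt]; positivity⟩
  obtain rfl : V = v ^ 2 / 2 := by linarith
  have hD : 0 < 1 + b / 3 * (2 * u / v) := by positivity
  -- `2 * u / v` is the Gaussian optimum (`b = 0`); the denominator is chosen so that `1 - s * b /
  -- 3` becomes its reciprocal.
  refine ⟨2 * u / v / (1 + b / 3 * (2 * u / v)), by positivity, ?_, ?_⟩
  · rw [div_mul_eq_mul_div, div_lt_iff₀ hD]; nlinarith
  · rw [hV2, Real.sqrt_sq hv.le, Real.sqrt_sq hu]
    have h1 : 1 - 2 * u / v / (1 + b / 3 * (2 * u / v)) * b / 3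
        = 1 / (1 + b / 3 * (2 * u / v)) := by field_simp; ring
    rw [h1]
    have : v * 3 + b * (2 * u) ≠ 0 := by positivity
    field_simp
    ring

/-! ### The second moment of the score of a round -/

theorem neg_mul_log_le {q : ℝ} (hq : 0 ≤ q) : -(q * Real.log q) ≤ 1 / Real.exp 1 := by
  rcases hq.eq_or_lt with rfl | hq
  · simp; positivity
  have h := Real.log_le_sub_one_of_pos (x := 1 / (Real.exp 1 * q)) (by positivity)
  rw [one_div, Real.log_inv, Real.log_mul (by positivity) hq.ne', Real.log_exp] at h
  have h2 : -Real.log q ≤ (Real.exp 1 * q)⁻¹ := by linarith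
  calc -(q * Real.log q) = q * -Real.log q := by ring
    _ ≤ q * (Real.exp 1 * q)⁻¹ := by gcongr
    _ = 1 / Real.exp 1 := by field_simp

/-- `q log² q = 4 (√q log √q)²`, which reduces the claim to the bound on `-x log x` at `x = √q`. -/
theorem mul_log_sq_le {q : ℝ} (hq : 0 ≤ q) (hq1 : q ≤ 1) :
    q * Real.log q ^ 2 ≤ 4 * (1 / Real.exp 1) ^ 2 := by
  have h := neg_mul_log_le (Real.sqrt_nonneg q)
  have h0 : 0 ≤ -(√q * Real.log (√q)) := by
    have := Real.log_nonpos (Real.sqrt_nonneg q) (Real.sqrt_le_one.2 hq1)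
    have := Real.sqrt_nonneg q
    nlinarith
  have h2 := pow_le_pow_left₀ h0 h 2
  rw [Real.log_sqrt hq] at h2
  have h3 := Real.sq_sqrt hq
  calc q * Real.log q ^ 2 = 4 * (-(√q * (Real.log q / 2))) ^ 2 := by
        rw [neg_sq, mul_pow, h3]; ring
    _ ≤ _ := by linarith

theorem mul_log_sq_le_of_half_le {q : ℝ} (hq : 1 / 2 ≤ q) (hq1 : q ≤ 1) :
    q * Real.log q ^ 2 ≤ 1 / Real.exp 1 * Real.log 2 := by
  have h := neg_mul_log_le (q := q) (by linarith)
  have h1 : -Real.log q ≤ Real.log 2 := by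
    have := Real.log_le_log (by norm_num) hq
    rw [one_div, Real.log_inv] at this
    linarith
  have h0 := Real.log_nonpos (by linarith) hq1
  calc q * Real.log q ^ 2 = -(q * Real.log q) * -Real.log q := by ring
    _ ≤ _ := mul_le_mul h h1 (by linarith) (by positivity)

/-- With `y = 1 / (e log 2)`, bounding each term by `4 y²` would give `8 y²`. The larger of `q` and
`1 - q` satisfies the better bound `y`, and `4 y² + y ≤ 8 y² - 1/4` because `y ≥ 1/2`. The saved
`1/4` is spent in `second_moment_le`. -/
theorem mul_logb_sq_add_le {q : ℝ} (hq : 0 ≤ q) (hq1 : q ≤ 1) :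
    q * Real.logb 2 q ^ 2 + (1 - q) * Real.logb 2 (1 - q) ^ 2
      ≤ 8 / Real.exp 1 ^ 2 * Real.logb 2 (Real.exp 1) ^ 2 - 1 / 4 := by
  wlog h : q ≤ 1 / 2 generalizing q
  · have := this (q := 1 - q) (by linarith) (by linarith) (by linarith)
    rw [sub_sub_cancel] at this; linarith
  have h1 := mul_log_sq_le hq hq1
  have h2 := mul_log_sq_le_of_half_le (q := 1 - q) (by linarith) (by linarith)
  have hl : 0 < Real.log 2 := Real.log_pos (by norm_num)
  have he := Real.exp_pos 1
  have hy : (1 : ℝ) / 2 ≤ 1 / Real.exp 1 / Real.log 2 := by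
    rw [div_div, div_le_div_iff₀ (by norm_num) (by positivity)]
    nlinarith [Real.exp_one_lt_d9, Real.log_two_lt_d9]
  simp only [Real.logb, Real.log_exp, div_pow]
  have e1 : q * (Real.log q ^ 2 / Real.log 2 ^ 2)
      ≤ 4 * (1 / Real.exp 1 / Real.log 2) ^ 2 := by
    rw [div_pow _ (Real.log 2), ← mul_div_assoc, ← mul_div_assoc]; gcongr
  have e2 : (1 - q) * (Real.log (1 - q) ^ 2 / Real.log 2 ^ 2)
      ≤ 1 / Real.exp 1 / Real.log 2 := by
    have : 1 / Real.exp 1 / Real.log 2 = 1 / Real.exp 1 * Real.log 2 / Real.log 2 ^ 2 := by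
      field_simp
    rw [this, ← mul_div_assoc]; gcongr
  have e3 : 8 / Real.exp 1 ^ 2 * (1 ^ 2 / Real.log 2 ^ 2)
      = 8 * (1 / Real.exp 1 / Real.log 2) ^ 2 := by field_simp
  rw [e3]
  nlinarith

/-- Expand the square of `Y + ℓ` with `Y = ξ + g`. The cross term is controlled by `ℓ ≤ 0` and
entropy at most 1, and `E[Y²]` by `(Y - lo - g)(hi + g - Y) ≥ 0` together with `E[Y] ≤ -E[ℓ]`. The
mean constraint is essential: `(hi + g)²` may exceed `(hi + G)²`, since `G ≤ g`. -/
theorem second_moment_le {ι : Type*} [Fintype ι] {w ξ ℓ : ι → ℝ} {lo hi g G K : ℝ}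
    (hw : ∀ i, 0 ≤ w i) (hw1 : ∑ i, w i = 1) (hℓ : ∀ i, ℓ i ≤ 0)
    (hlo : ∀ i, lo ≤ ξ i) (hhi : ∀ i, ξ i ≤ hi) (hlo0 : lo ≤ 0) (hG : G ≤ g) (hg : g ≤ 0)
    (hent : -∑ i, w i * ℓ i ≤ 1) (hmean : ∑ i, w i * (ξ i + g + ℓ i) ≤ 0)
    (hsq : ∑ i, w i * ℓ i ^ 2 ≤ K - 1 / 4) :
    ∑ i, w i * (ξ i + g + ℓ i) ^ 2
      ≤ max ((hi + G) ^ 2) ((lo + G) ^ 2) + 2 * max (-(G + lo)) 0 + K := by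
  have hent0 : 0 ≤ -∑ i, w i * ℓ i := by
    rw [← Finset.sum_neg_distrib]
    exact Finset.sum_nonneg fun i _ => by nlinarith [hw i, hℓ i]
  have hEY : ∑ i, w i * (ξ i + g) ≤ -∑ i, w i * ℓ i := by
    have : ∑ i, w i * (ξ i + g + ℓ i) = ∑ i, w i * (ξ i + g) + ∑ i, w i * ℓ i := by
      rw [← Finset.sum_add_distrib]; exact Finset.sum_congr rfl fun i _ => by ring
    linarith
  have hsplit : ∑ i, w i * (ξ i + g + ℓ i) ^ 2
      = ∑ i, w i * (ξ i + g) ^ 2 + 2 * ∑ i, w i * ((ξ i + g) * ℓ i) + ∑ i, w i * ℓ i ^ 2 := by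
    rw [Finset.mul_sum, ← Finset.sum_add_distrib, ← Finset.sum_add_distrib]
    exact Finset.sum_congr rfl fun i _ => by ring
  have hcross : ∑ i, w i * ((ξ i + g) * ℓ i) ≤ (lo + g) * ∑ i, w i * ℓ i := by
    rw [Finset.mul_sum]
    refine Finset.sum_le_sum fun i _ => ?_
    have : (ξ i + g) * ℓ i ≤ (lo + g) * ℓ i :=
      mul_le_mul_of_nonpos_right (by linarith [hlo i]) (hℓ i)
    nlinarith [hw i, mul_le_mul_of_nonneg_left this (hw i)]
  have hquad : ∑ i, w i * (ξ i + g) ^ 2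
      ≤ (hi + lo + 2 * g) * ∑ i, w i * (ξ i + g) - (hi + g) * (lo + g) := by
    have : ∑ i, w i * ((ξ i + g - (lo + g)) * (hi + g - (ξ i + g)))
        = (hi + lo + 2 * g) * ∑ i, w i * (ξ i + g) - (hi + g) * (lo + g) * ∑ i, w i
          - ∑ i, w i * (ξ i + g) ^ 2 := by
      rw [Finset.mul_sum, Finset.mul_sum, ← Finset.sum_sub_distrib, ← Finset.sum_sub_distrib]
      exact Finset.sum_congr rfl fun i _ => by ring
    have h0 : 0 ≤ ∑ i, w i * ((ξ i + g - (lo + g)) * (hi + g - (ξ i + g))) :=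
      Finset.sum_nonneg fun i _ => mul_nonneg (hw i)
        (mul_nonneg (by linarith [hlo i]) (by linarith [hhi i]))
    rw [hw1] at this
    linarith
  have hlohi : lo ≤ hi := by
    by_contra hcon
    have : IsEmpty ι := ⟨fun i => hcon ((hlo i).trans (hhi i))⟩
    simp at hw1
  set η := -∑ i, w i * ℓ i with hη
  have hcross' : ∑ i, w i * ((ξ i + g) * ℓ i) ≤ -(lo + g) * η := by rw [hη]; linarith
  have hmax : -(G + lo) ≤ max (-(G + lo)) 0 := le_max_left _ _
  have hm1 := le_max_left ((hi + G) ^ 2) ((lo + G) ^ 2)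
  have hm2 := le_max_right ((hi + G) ^ 2) ((lo + G) ^ 2)
  have hη1 : -(lo + g) * η ≤ -(lo + g) := by nlinarith
  rcases le_total 0 (hi + lo + 2 * g) with hd | hd
  · have hq2 : ∑ i, w i * (ξ i + g) ^ 2
        ≤ (hi + lo + 2 * g) * η - (hi + g) * (lo + g) := by
      have := mul_le_mul_of_nonneg_left hEY hd
      linarith
    -- At `η = 1` the left side is `hi - lo - (hi + g) * (lo + g)`, nonincreasing in `g` here. If `d
    -- = hi + lo + 2 * G ≥ 0`, compare with `g = G`: the slack is at least `(d - 1/2)²`, which uses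
    -- up the `1/4`. If `d ≤ 0`, the product term is at most `((hi - lo) / 2)² ≤ (lo + G)²`.
    have hkey : (hi + lo + 2 * g) * η - (hi + g) * (lo + g) + 2 * (-(lo + g))
        ≤ max ((hi + G) ^ 2) ((lo + G) ^ 2) + 2 * (-(G + lo)) + 1 / 4 := by
      have hdη : (hi + lo + 2 * g) * η ≤ hi + lo + 2 * g := by nlinarith
      rcases le_total 0 (hi + lo + 2 * G) with hdG | hdG
      · nlinarith [sq_nonneg (hi + lo + 2 * G - 1 / 2),
          mul_nonneg (sub_nonneg.2 hlohi) hdG, mul_nonneg (sub_nonneg.2 hG) hdG,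
          mul_nonneg (sub_nonneg.2 hG) hd]
      · nlinarith [sq_nonneg (hi + lo + 2 * G),
          mul_nonneg (sub_nonneg.2 hlohi) (neg_nonneg.2 hdG), sq_nonneg (hi + lo + 2 * g)]
    linarith
  -- Here `lo + g` is the endpoint of largest absolute value.
  · have hq2 : ∑ i, w i * (ξ i + g) ^ 2 ≤ (lo + g) ^ 2 := by
      calc ∑ i, w i * (ξ i + g) ^ 2 ≤ ∑ i, w i * (lo + g) ^ 2 :=
            Finset.sum_le_sum fun i _ => mul_le_mul_of_nonneg_left
              (by nlinarith [hlo i, hhi i]) (hw i)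
        _ = (lo + g) ^ 2 := by rw [← Finset.sum_mul, hw1, one_mul]
    nlinarith

/-! ### Probabilities as sums -/

section Prob

variable {Ω : Type*} (μ : PMF Ω)

theorem prob_eq_tsum (S : Set Ω) :
    prob μ S = ∑' o, S.indicator (fun o => (μ o).toReal) o := by
  rw [prob, PMF.toOuterMeasure_apply, ENNReal.tsum_toReal_eq]
  · refine tsum_congr fun o => ?_
    by_cases h : o ∈ S <;> simp [h]
  · intro o
    by_cases h : o ∈ S <;> simp [h, μ.apply_ne_top]

theorem summable_mass : Summable fun o => (μ o).toReal :=
  ENNReal.summable_toReal μ.tsum_coe_ne_top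

theorem hasSum_prob (S : Set Ω) :
    HasSum (S.indicator fun o => (μ o).toReal) (prob μ S) := by
  rw [prob_eq_tsum]
  exact ((summable_mass μ).indicator S).hasSum

theorem prob_nonneg (S : Set Ω) : 0 ≤ prob μ S := ENNReal.toReal_nonneg

theorem prob_univ : prob μ Set.univ = 1 := by
  rw [prob, (μ.toOuterMeasure_apply_eq_one_iff _).2 (Set.subset_univ _), ENNReal.toReal_one]

theorem prob_mono {S T : Set Ω} (h : S ⊆ T) : prob μ S ≤ prob μ T :=
  hasSum_le (fun o => Set.indicator_le_indicator_of_subset h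
    (fun _ => ENNReal.toReal_nonneg) o) (hasSum_prob μ S) (hasSum_prob μ T)

theorem prob_le_one (S : Set Ω) : prob μ S ≤ 1 :=
  (prob_mono μ (Set.subset_univ S)).trans_eq (prob_univ μ)

theorem prob_singleton (o : Ω) : prob μ {o} = (μ o).toReal := by
  rw [prob, PMF.toOuterMeasure_apply_singleton]

theorem prob_union_le (S T : Set Ω) : prob μ (S ∪ T) ≤ prob μ S + prob μ T := by
  refine hasSum_le (fun o => ?_) (hasSum_prob μ (S ∪ T))
    ((hasSum_prob μ S).add (hasSum_prob μ T))
  have h : 0 ≤ (μ o).toReal := ENNReal.toReal_nonneg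
  by_cases h1 : o ∈ S <;> by_cases h2 : o ∈ T <;> simp [h1, h2]

theorem prob_compl (S : Set Ω) : prob μ Sᶜ = 1 - prob μ S := by
  have h := (hasSum_prob μ S).add (hasSum_prob μ Sᶜ)
  have h2 := hasSum_prob μ Set.univ
  rw [prob_univ] at h2
  have h3 := h.unique (by convert h2 using 1; ext o; by_cases ho : o ∈ S <;> simp [ho])
  linarith

theorem prob_eq_sum_of_subset_range {ι : Type*} [Fintype ι] {g : ι → Ω}
    (hg : Function.Injective g) {S : Set Ω} (hS : S ⊆ Set.range g) :
    prob μ S = ∑ i, S.indicator (fun o => (μ o).toReal) (g i) := by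
  rw [prob_eq_tsum, ← tsum_fintype (L := .unconditional _)]
  exact (hg.tsum_eq (Set.support_indicator_subset.trans hS)).symm

theorem condProb_nonneg (S T : Set Ω) : 0 ≤ condProb μ S T :=
  div_nonneg (prob_nonneg μ _) (prob_nonneg μ _)

theorem prob_inter_eq_condProb_mul {S T : Set Ω} (h : prob μ T ≠ 0) :
    prob μ (S ∩ T) = condProb μ S T * prob μ T := by
  rw [condProb, div_mul_cancel₀ _ h]

/-- The probability of an event as a sum over the last component of the outcomes. -/
theorem hasSum_prob_fiber {A X L : Type*} [Fintype A] [Fintype X] (μ : PMF (A × X × L))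
    (S : Set (A × X × L)) :
    HasSum (fun lam => ∑ x, ∑ a, S.indicator (fun o => (μ o).toReal) (a, x, lam)) (prob μ S) := by
  let e : L × (X × A) ≃ A × X × L :=
    ⟨fun z => (z.2.2, z.2.1, z.1), fun z => (z.2.2, (z.2.1, z.1)), fun _ => rfl, fun _ => rfl⟩
  have h := ((e.hasSum_iff (f := S.indicator fun o => (μ o).toReal)).2
    (hasSum_prob μ S)).prod_fiberwise (fun lam => hasSum_fintype _)
  convert h using 2 with lam
  rw [Fintype.sum_prod_type]
  rfl

/-- Only the last component can be infinite, so every finite set of indices lies in a box that is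
full in the other three; bounding these boxes avoids a separate summability proof. -/
theorem tsum_le_of_hasSum_fiber {A B C L : Type*} [Fintype A] [Fintype B] [Fintype C]
    {g : A × B × C × L → ℝ} {b : L → ℝ} {c : ℝ} (hg : ∀ z, 0 ≤ g z)
    (hgb : ∀ lam, ∑ x, ∑ k, ∑ s, g (k, s, x, lam) ≤ b lam) (hb : HasSum b c) :
    ∑' z, g z ≤ c := by
  classical
  have hb0 : ∀ lam, 0 ≤ b lam := fun lam =>
    (Finset.sum_nonneg fun x _ => Finset.sum_nonneg fun k _ => Finset.sum_nonneg fun s _ =>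
      hg _).trans (hgb lam)
  refine Real.tsum_le_of_sum_le hg fun F => ?_
  calc ∑ z ∈ F, g z
      ≤ ∑ z ∈ (Finset.univ ×ˢ Finset.univ ×ˢ Finset.univ ×ˢ F.image fun z => z.2.2.2), g z := by
        refine Finset.sum_le_sum_of_subset_of_nonneg (fun z hz => ?_) fun z _ _ => hg z
        simp only [Finset.mem_product, Finset.mem_univ, true_and]
        exact Finset.mem_image_of_mem _ hz
    _ = ∑ lam ∈ F.image fun z => z.2.2.2, ∑ x, ∑ k, ∑ s, g (k, s, x, lam) := by
        simp only [Finset.sum_product]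
        simp only [Finset.sum_comm (t := F.image fun z => z.2.2.2)]
        refine Finset.sum_congr rfl fun lam _ => ?_
        rw [Finset.sum_comm' (t' := Finset.univ) (s' := fun _ => Finset.univ) (by simp)]
        simp only [Finset.sum_comm (s := (Finset.univ : Finset C))]
        rw [Finset.sum_comm]
    _ ≤ ∑ lam ∈ F.image fun z => z.2.2.2, b lam := Finset.sum_le_sum fun lam _ => hgb lam
    _ ≤ c := sum_le_hasSum _ (fun lam _ => hb0 lam) hb

end Prob

/-! ### Sequential products -/

section Past

variable {α : Type*}

theorem past_castSucc_snoc {n : ℕ} (v : Fin n → α) (c : α) (i : Fin n) :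
    past i.castSucc (Fin.snoc v c : Fin (n + 1) → α) = past i v := by
  funext j
  exact Fin.snoc_castSucc (α := fun _ => α) (p := v) (x := c) (i := j.castLE i.isLt.le)

theorem past_last_snoc {n : ℕ} (v : Fin n → α) (c : α) :
    past (Fin.last n) (Fin.snoc v c : Fin (n + 1) → α) = v := by
  funext j
  exact Fin.snoc_castSucc (α := fun _ => α) (p := v) (x := c) (i := j)

variable [Fintype α]

/-- Earlier factors do not see the last entry, so it can be summed out first. This is the tower
property of conditional expectation in sum form. -/
theorem sum_prod_past_succ {n : ℕ} (F : (i : Fin (n + 1)) → (Fin i → α) → α → ℝ) :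
    ∑ u : Fin (n + 1) → α, ∏ i, F i (past i u) (u i)
      = ∑ v : Fin n → α, (∏ i : Fin n, F i.castSucc (past i v) (v i))
          * ∑ c, F (Fin.last n) v c := by
  rw [← (Fin.snocEquiv fun _ => α).sum_comp, Fintype.sum_prod_type, Finset.sum_comm]
  refine Finset.sum_congr rfl fun v _ => ?_
  rw [Finset.mul_sum]
  refine Finset.sum_congr rfl fun c _ => ?_
  change ∏ i, F i (past i (Fin.snoc v c : Fin (n + 1) → α)) ((Fin.snoc v c : Fin (n + 1) → α) i)
    = _
  rw [Fin.prod_univ_castSucc, past_last_snoc, Fin.snoc_last]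
  congr 1
  refine Finset.prod_congr rfl fun i _ => ?_
  rw [past_castSucc_snoc, Fin.snoc_castSucc]

theorem sum_prod_past_le {C : ℝ} {n : ℕ} (F : (i : Fin n) → (Fin i → α) → α → ℝ)
    (hF : ∀ i v c, 0 ≤ F i v c) (hC : ∀ i v, ∑ c, F i v c ≤ C) :
    ∑ u : Fin n → α, ∏ i, F i (past i u) (u i) ≤ C ^ n := by
  induction n with
  | zero => simp
  | succ n ih =>
    have hC0 : 0 ≤ C := (Finset.sum_nonneg fun c _ => hF _ _ c).trans
      (hC ⟨0, n.succ_pos⟩ fun j => j.elim0)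
    rw [sum_prod_past_succ]
    calc _ ≤ ∑ v : Fin n → α, (∏ i : Fin n, F i.castSucc (past i v) (v i)) * C :=
          Finset.sum_le_sum fun v _ => mul_le_mul_of_nonneg_left (hC (Fin.last n) v)
            (Finset.prod_nonneg fun i _ => hF i.castSucc _ _)
      _ ≤ C ^ n * C := by
          rw [← Finset.sum_mul]
          exact mul_le_mul_of_nonneg_right
            (ih (fun i => F i.castSucc) (fun i => hF i.castSucc) fun i => hC i.castSucc) hC0
      _ = C ^ (n + 1) := (pow_succ _ _).symm

theorem sum_prod_past_eq_one {n : ℕ} (F : (i : Fin n) → (Fin i → α) → α → ℝ)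
    (hF : ∀ i v, ∑ c, F i v c = 1) :
    ∑ u : Fin n → α, ∏ i, F i (past i u) (u i) = 1 := by
  induction n with
  | zero => simp
  | succ n ih =>
    rw [sum_prod_past_succ, ← ih (fun i => F i.castSucc) fun i => hF i.castSucc]
    exact Finset.sum_congr rfl fun v _ => by rw [hF (Fin.last n) v, mul_one]

/-- Bernstein's inequality for adapted sums with conditional means at most zero. -/
theorem sum_prod_past_indicator_le {n : ℕ} (hn : 0 < n)
    (w U : (i : Fin n) → (Fin i → α) → α → ℝ) {b V lam : ℝ} (hV : 0 < V) (hlam : 0 ≤ lam)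
    (ht : 0 ≤ √(2 * V) * √lam + b / 3 * lam)
    (hw : ∀ i v c, 0 ≤ w i v c) (hw1 : ∀ i v, ∑ c, w i v c = 1) (hU : ∀ i v c, U i v c ≤ b)
    (hmean : ∀ i v, ∑ c, w i v c * U i v c ≤ 0)
    (hvar : ∀ i v, ∑ c, w i v c * U i v c ^ 2 ≤ V) :
    ∑ u : Fin n → α,
      {u | n * (√(2 * V) * √lam + b / 3 * lam) < ∑ i, U i (past i u) (u i)}.indicator
        (fun u => ∏ i, w i (past i u) (u i)) u ≤ Real.exp (-(n * lam)) := by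
  set t := √(2 * V) * √lam + b / 3 * lam with htdef
  have hprod : ∀ u : Fin n → α, 0 ≤ ∏ i, w i (past i u) (u i) := fun u =>
    Finset.prod_nonneg fun i _ => hw i _ _
  -- For `b < 0` the sum is nonpositive and `t ≥ 0` makes the event empty; the Bernstein exponent
  -- needs `b ≥ 0`.
  rcases lt_or_ge b 0 with hb | hb
  · refine (Finset.sum_nonpos fun u _ => ?_).trans (Real.exp_pos _).le
    rw [Set.indicator_of_notMem]
    rw [Set.mem_ofPred_eq, not_lt]
    calc ∑ i, U i (past i u) (u i) ≤ 0 :=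
          Finset.sum_nonpos fun i _ => (hU i _ _).trans hb.le
      _ ≤ n * t := by positivity
  obtain ⟨s, hs, hsb, hexp⟩ := exists_bernstein_exponent hb hV hlam
  rw [← htdef] at hexp
  -- Chernoff: the indicator is at most `exp (s * (∑ U - n * t))`, which factorises over the rounds.
  calc _ ≤ ∑ u : Fin n → α, Real.exp (-(s * (n * t)))
          * ∏ i, w i (past i u) (u i) * Real.exp (s * U i (past i u) (u i)) := by
        refine Finset.sum_le_sum fun u _ => ?_
        rw [Finset.prod_mul_distrib, ← Real.exp_sum, ← Finset.mul_sum, mul_left_comm,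
          ← Real.exp_add]
        by_cases hu : n * t < ∑ i, U i (past i u) (u i)
        · rw [Set.indicator_of_mem (by exact hu)]
          refine le_mul_of_one_le_right (hprod u) (Real.one_le_exp ?_)
          nlinarith
        · rw [Set.indicator_of_notMem (by exact hu)]
          exact mul_nonneg (hprod u) (Real.exp_pos _).le
    _ ≤ Real.exp (-(s * (n * t))) * Real.exp (s ^ 2 * V / (2 * (1 - s * b / 3))) ^ n := by
        rw [← Finset.mul_sum]
        refine mul_le_mul_of_nonneg_left ?_ (Real.exp_pos _).le
        exact sum_prod_past_le (fun i v c => w i v c * Real.exp (s * U i v c))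
          (fun i v c => mul_nonneg (hw i v c) (Real.exp_pos _).le) fun i v =>
            sum_mul_exp_le (hw i v) (hw1 i v) (hU i v) hs hsb (hmean i v) (hvar i v)
    _ = Real.exp (-(n * lam)) := by
        rw [← Real.exp_nat_mul, ← Real.exp_add]
        congr 1
        linear_combination (n : ℝ) * hexp

end Past

/-! ### Quantum behaviours -/

/-- Sending the vacuum for both inputs gives perfect correlations without energy. -/
theorem vacuum_mem_Q : ((1, 0) : (Fin 2 → ℝ) × (Fin 2 → ℝ)) ∈ Q := by
  refine subset_convexHull ℝ _ ⟨ℂ, inferInstance, inferInstance, inferInstance, ⟨?_⟩⟩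
  exact
    { ι := Unit
      b := (OrthonormalBasis.singleton Unit ℂ).toHilbertBasis
      e := 0
      vac := ()
      ρ := 1
      M := 1
      energy_vac := rfl
      energy_gap := fun j hj => (hj rfl).elim
      state_pos := fun _ => ContinuousLinearMap.isPositive_one
      state_trace := fun x => by
        simp
      neg_one_le_M := ContinuousLinearMap.isPositive_one.add ContinuousLinearMap.isPositive_one
      M_le_one := by rw [sub_self]; exact ContinuousLinearMap.isPositive_zero
      corr := fun x => by
        simp
      energy_summable := fun x => (hasSum_fintype _).summable
      energy_le := fun x => by simp }

theorem energy_nonneg_of_mem_Q {B : (Fin 2 → ℝ) × (Fin 2 → ℝ)} (hB : B ∈ Q) : 0 ≤ B.2 := by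
  have hconv : Convex ℝ {B : (Fin 2 → ℝ) × (Fin 2 → ℝ) | 0 ≤ B.2} :=
    (convex_Ici (𝕜 := ℝ) (0 : Fin 2 → ℝ)).is_linear_preimage
      (f := fun B : (Fin 2 → ℝ) × (Fin 2 → ℝ) => B.2) ⟨fun _ _ => rfl, fun _ _ => rfl⟩
  refine convexHull_min ?_ hconv hB
  rintro B ⟨K, _, _, _, ⟨R⟩⟩ x
  refine le_trans (tsum_nonneg fun j => mul_nonneg ?_ ?_) (R.energy_le x)
  · by_cases h : j = R.vac
    · rw [h, R.energy_vac]
    · exact zero_le_one.trans (R.energy_gap j h)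
  · exact (Complex.le_def.1 ((R.state_pos x).inner_nonneg_right (R.b j))).1

/-! ### A single round -/

/-- The probability of the output `a` for the correlation `e`. -/
noncomputable def outProb (e : ℝ) (a : Bool) : ℝ := (1 + sgn a * e) / 2

theorem outProb_nonneg {e : ℝ} (he : |e| ≤ 1) (a : Bool) : 0 ≤ outProb e a := by
  have := abs_le.1 he
  cases a <;> simp [outProb, sgn] <;> linarith

theorem outProb_le_one {e : ℝ} (he : |e| ≤ 1) (a : Bool) : outProb e a ≤ 1 := by
  have := abs_le.1 he
  cases a <;> simp [outProb, sgn] <;> linarith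

theorem sum_outProb (e : ℝ) : ∑ a, outProb e a = 1 := by
  simp [outProb, sgn]; ring

theorem outProb_false (e : ℝ) : outProb e false = 1 - outProb e true := by
  simp [outProb, sgn]; ring

theorem H_eq (p E : Fin 2 → ℝ) :
    H p E = -∑ z : Bool × Fin 2,
      p z.2 * outProb (E z.2) z.1 * Real.logb 2 (outProb (E z.2) z.1) := by
  rw [H, Fintype.sum_prod_type]; rfl

theorem H_le_one {p E : Fin 2 → ℝ} (hp : ∀ x, 0 ≤ p x) (hp1 : ∑ x, p x = 1) : H p E ≤ 1 := by
  have hl : 0 < Real.log 2 := Real.log_pos one_lt_two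
  rw [H_eq, Fintype.sum_prod_type_right, ← hp1, ← Finset.sum_neg_distrib]
  refine Finset.sum_le_sum fun x _ => ?_
  have h := Real.binEntropy_le_log_two (p := outProb (E x) true)
  rw [Real.binEntropy, Real.log_inv, Real.log_inv, ← outProb_false] at h
  have : -∑ a, p x * outProb (E x) a * Real.logb 2 (outProb (E x) a)
      = p x * ((outProb (E x) true * -Real.log (outProb (E x) true)
        + outProb (E x) false * -Real.log (outProb (E x) false)) / Real.log 2) := by
    simp [Real.logb]; ring
  rw [this]
  refine mul_le_of_le_one_right (hp x) ?_
  rwa [div_le_one hl]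

namespace Args

variable {P : Args}

/-- The score of a round with correlations `e` and energies `w`. -/
noncomputable def score (P : Args) (e w : Fin 2 → ℝ) (z : Bool × Fin 2) : ℝ :=
  P.ξ z.1 z.2 + ∑ x, P.γ x * w x + Real.logb 2 (outProb (e z.2) z.1)

theorem le_ξmax (a : Bool) (x : Fin 2) : P.ξ a x ≤ P.ξmax :=
  le_ciSup (f := fun z : Bool × Fin 2 => P.ξ z.1 z.2) (Set.finite_range _).bddAbove (a, x)

theorem ξmin_le (a : Bool) (x : Fin 2) : P.ξmin ≤ P.ξ a x :=
  ciInf_le (f := fun z : Bool × Fin 2 => P.ξ z.1 z.2) (Set.finite_range _).bddBelow (a, x)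

theorem sum_ξ (hp : ∀ x, 0 < P.p x) (e : Fin 2 → ℝ) :
    ∑ z : Bool × Fin 2, P.p z.2 * outProb (e z.2) z.1 * P.ξ z.1 z.2
      = ∑ x, P.α x + ∑ x, P.β x * e x := by
  have h0 := (hp 0).ne'
  have h1 := (hp 1).ne'
  rw [Fintype.sum_prod_type_right]
  simp [outProb, sgn, ξ]
  field_simp
  ring

theorem sum_weight (hp1 : ∑ x, P.p x = 1) (e : Fin 2 → ℝ) :
    ∑ z : Bool × Fin 2, P.p z.2 * outProb (e z.2) z.1 = 1 := by
  rw [Fintype.sum_prod_type_right]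
  simp only [← Finset.mul_sum, sum_outProb, mul_one, hp1]

theorem V_pos : 0 < P.V := by
  have h1 : 0 ≤ max ((P.ξmax + P.γbar) ^ 2) ((P.ξmin + P.γbar) ^ 2) :=
    le_max_of_le_left (sq_nonneg _)
  have h2 := le_max_right (-(Real.logb 2 (Fintype.card Bool) * (P.γbar + P.ξmin))) 0
  have h3 : 0 < Real.logb 2 (Real.exp 1) :=
    Real.logb_pos one_lt_two (by linarith [Real.add_one_le_exp 1])
  have h4 : 0 < 4 * (Fintype.card Bool : ℝ) / Real.exp 1 ^ 2
      * Real.logb 2 (Real.exp 1) ^ 2 := by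
    rw [Fintype.card_bool]; positivity
  rw [V]; linarith

/-- The vacuum behaviour is deterministic and costs no energy, so the trade-off inequality makes the
mean of `ξ` under it at most 0. -/
theorem Valid.ξmin_nonpos (hP : P.Valid) : P.ξmin ≤ 0 := by
  have h := hP.tradeoff.2 (1, 0) ⟨vacuum_mem_Q, hP.avg_nonneg.trans hP.avg_le_pk⟩
  have hw1 := sum_weight hP.p_sum 1
  have hH : H P.p 1 = 0 := by simp [H, sgn]
  have hsum := sum_ξ hP.p_pos 1
  have hle : ∑ z : Bool × Fin 2, P.p z.2 * outProb ((1 : Fin 2 → ℝ) z.2) z.1 * P.ξmin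
      ≤ ∑ z : Bool × Fin 2, P.p z.2 * outProb ((1 : Fin 2 → ℝ) z.2) z.1 * P.ξ z.1 z.2 :=
    Finset.sum_le_sum fun z _ => mul_le_mul_of_nonneg_left (ξmin_le _ _)
      (mul_nonneg (hP.p_pos _).le (outProb_nonneg (by simp) _))
  rw [← Finset.sum_mul, hw1, one_mul, hsum] at hle
  simp only [hH, Pi.zero_apply, mul_zero, Finset.sum_const_zero, add_zero] at h
  linarith

theorem Valid.score_le (hP : P.Valid) {e w : Fin 2 → ℝ} (hB : (e, w) ∈ Qpk P.ωpk)
    (he : ∀ x, |e x| ≤ 1) (z : Bool × Fin 2) : P.score e w z ≤ P.ξmax := by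
  have h1 := le_ξmax (P := P) z.1 z.2
  have h2 : Real.logb 2 (outProb (e z.2) z.1) ≤ 0 :=
    Real.logb_nonpos one_lt_two (outProb_nonneg (he _) _) (outProb_le_one (he _) _)
  have h3 : ∑ x, P.γ x * w x ≤ 0 := Finset.sum_nonpos fun x _ =>
    mul_nonpos_of_nonpos_of_nonneg (hP.tradeoff.1 x) (energy_nonneg_of_mem_Q hB.1 x)
  rw [score]; linarith

theorem Valid.sum_score_nonpos (hP : P.Valid) {e w : Fin 2 → ℝ} (hB : (e, w) ∈ Qpk P.ωpk) :
    ∑ z : Bool × Fin 2, P.p z.2 * outProb (e z.2) z.1 * P.score e w z ≤ 0 := by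
  have h := hP.tradeoff.2 _ hB
  rw [H_eq] at h
  have hsplit : ∑ z : Bool × Fin 2, P.p z.2 * outProb (e z.2) z.1 * P.score e w z
      = ∑ z : Bool × Fin 2, P.p z.2 * outProb (e z.2) z.1 * P.ξ z.1 z.2
        + (∑ z : Bool × Fin 2, P.p z.2 * outProb (e z.2) z.1) * ∑ x, P.γ x * w x
        + ∑ z : Bool × Fin 2,
          P.p z.2 * outProb (e z.2) z.1 * Real.logb 2 (outProb (e z.2) z.1) := by
    rw [Finset.sum_mul, ← Finset.sum_add_distrib, ← Finset.sum_add_distrib]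
    exact Finset.sum_congr rfl fun z _ => by rw [score]; ring
  rw [hsplit, sum_weight hP.p_sum, sum_ξ hP.p_pos]
  linarith

theorem Valid.sum_score_sq_le (hP : P.Valid) {e w : Fin 2 → ℝ} (hB : (e, w) ∈ Qpk P.ωpk)
    (he : ∀ x, |e x| ≤ 1) :
    ∑ z : Bool × Fin 2, P.p z.2 * outProb (e z.2) z.1 * P.score e w z ^ 2 ≤ P.V := by
  have hw0 := energy_nonneg_of_mem_Q hB.1
  have hw1 : w ≤ 1 := hB.2.trans hP.pk_le_one
  have hγ := hP.tradeoff.1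
  have hlog : Real.logb 2 (Fintype.card Bool) = 1 := by simp
  have hsq : ∑ z : Bool × Fin 2,
      P.p z.2 * outProb (e z.2) z.1 * Real.logb 2 (outProb (e z.2) z.1) ^ 2
        ≤ 4 * (Fintype.card Bool : ℝ) / Real.exp 1 ^ 2 * Real.logb 2 (Real.exp 1) ^ 2
          - 1 / 4 := by
    rw [Fintype.sum_prod_type_right]
    calc _ ≤ ∑ x, P.p x * (4 * (Fintype.card Bool : ℝ) / Real.exp 1 ^ 2
            * Real.logb 2 (Real.exp 1) ^ 2 - 1 / 4) := by
          refine Finset.sum_le_sum fun x _ => ?_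
          simp only [mul_assoc (P.p x), ← Finset.mul_sum]
          refine mul_le_mul_of_nonneg_left ?_ (hP.p_pos x).le
          have := mul_logb_sq_add_le (outProb_nonneg (he x) true) (outProb_le_one (he x) true)
          rw [Fintype.sum_bool, outProb_false, Fintype.card_bool]
          refine this.trans_eq ?_
          norm_num
      _ = _ := by rw [← Finset.sum_mul, hP.p_sum, one_mul]
  have hmain := second_moment_le (w := fun z : Bool × Fin 2 => P.p z.2 * outProb (e z.2) z.1)
    (ξ := fun z => P.ξ z.1 z.2) (ℓ := fun z => Real.logb 2 (outProb (e z.2) z.1))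
    (lo := P.ξmin) (hi := P.ξmax) (g := ∑ x, P.γ x * w x) (G := P.γbar)
    (fun z => mul_nonneg (hP.p_pos _).le (outProb_nonneg (he _) _)) (sum_weight hP.p_sum e)
    (fun z => Real.logb_nonpos one_lt_two (outProb_nonneg (he _) _) (outProb_le_one (he _) _))
    (fun z => ξmin_le _ _) (fun z => le_ξmax _ _) hP.ξmin_nonpos
    (Finset.sum_le_sum fun x _ => by
      have := hγ x; have := hw1 x
      simp only [Pi.zero_apply, Pi.one_apply] at *
      nlinarith)
    (Finset.sum_nonpos fun x _ => mul_nonpos_of_nonpos_of_nonneg (hγ x) (hw0 x))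
    (by rw [← H_eq]; exact H_le_one (fun x => (hP.p_pos x).le) hP.p_sum)
    (hP.sum_score_nonpos hB) hsq
  rw [V, hlog, one_mul]
  exact hmain

end Args

/-! ### The law of the device -/

/-- The runs that agree with `o` in the first `k` rounds and in the adversary's information. -/
def prefixEvent {n : ℕ} {L : Type*} (k : ℕ) (o : Run n L) : Set (Run n L) :=
  {o' | (∀ j : Fin n, j < k → o'.1 j = o.1 j ∧ o'.2.1 j = o.2.1 j) ∧ o'.2.2 = o.2.2}

theorem pastEvent_eq_prefixEvent {n : ℕ} {L : Type*} (i : Fin n) (o : Run n L) :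
    pastEvent i (past i o.1) (past i o.2.1) o.2.2 = prefixEvent i o := by
  ext o'
  simp only [pastEvent, prefixEvent, Set.mem_ofPred_eq, funext_iff, past]
  constructor
  · rintro ⟨h1, h2, h3⟩
    exact ⟨fun j hj => ⟨h1 ⟨j, hj⟩, h2 ⟨j, hj⟩⟩, h3⟩
  · rintro ⟨h1, h2⟩
    exact ⟨fun j => (h1 _ j.isLt).1, fun j => (h1 _ j.isLt).2, h2⟩

theorem prefixEvent_succ {n : ℕ} {L : Type*} (i : Fin n) (o : Run n L) :
    prefixEvent (i + 1) o
      = {o' | o'.1 i = o.1 i} ∩ ({o' | o'.2.1 i = o.2.1 i} ∩ prefixEvent i o) := by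
  ext o'
  simp only [prefixEvent, Set.mem_ofPred_eq, Set.mem_inter_iff]
  constructor
  · rintro ⟨h1, h2⟩
    exact ⟨(h1 i (by simp)).1, (h1 i (by simp)).2, fun j hj => h1 j (by omega), h2⟩
  · rintro ⟨h1, h2, h3, h4⟩
    refine ⟨fun j hj => ?_, h4⟩
    rcases Nat.lt_succ_iff_lt_or_eq.1 hj with h | h
    · exact h3 j h
    · rw [Fin.ext h]; exact ⟨h1, h2⟩

/-- The conditional probability of the outputs given the inputs and the adversary's
information, as the product over the rounds. -/
noncomputable def outputProb {n : ℕ} {L : Type*} (E : RoundFun n L) (o : Run n L) : ℝ :=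
  ∏ i, outProb (E i (past i o.1) (past i o.2.1) o.2.2 (o.2.1 i)) (o.1 i)

/-- The assumptions say nothing about pasts of probability zero. Substituting the vacuum behaviour
there makes the round bounds unconditional without affecting the law, which factorises by the chain
rule. -/
theorem exists_regular_device {n : ℕ} {L : Type*} {μ : PMF (Run n L)} {E ω : RoundFun n L}
    {p ωpk ωavg : Fin 2 → ℝ} {εω : ℝ} (hμ : DeviceAssumptions μ E ω p ωpk ωavg εω)
    (hp : ∀ x, 0 < p x) (hpk : 0 ≤ ωpk) :
    ∃ E' ω' : RoundFun n L,
      (∀ i a x lam, (E' i a x lam, ω' i a x lam) ∈ Qpk ωpk) ∧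
      (∀ i a x lam x₀, |E' i a x lam x₀| ≤ 1) ∧
      (∀ o, (μ o).toReal = prob μ {o' | o'.2.2 = o.2.2} * (∏ i, p (o.2.1 i))
        * outputProb E' o) ∧
      ∀ o, μ o ≠ 0 → ∀ i, ω' i (past i o.1) (past i o.2.1) o.2.2
        = ω i (past i o.1) (past i o.2.1) o.2.2 := by
  classical
  let E' : RoundFun n L := fun i a x lam =>
    if prob μ (pastEvent i a x lam) = 0 then 1 else E i a x lam
  let ω' : RoundFun n L := fun i a x lam =>
    if prob μ (pastEvent i a x lam) = 0 then 0 else ω i a x lam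
  have hin : ∀ i a x lam x₀, prob μ (pastEvent i a x lam) ≠ 0 →
      prob μ ({o | o.2.1 i = x₀} ∩ pastEvent i a x lam)
        = p x₀ * prob μ (pastEvent i a x lam) := fun i a x lam x₀ h => by
    rw [prob_inter_eq_condProb_mul μ h, hμ.input i a x lam h x₀]
  refine ⟨E', ω', fun i a x lam => ?_, fun i a x lam x₀ => ?_, fun o => ?_, fun o ho i => ?_⟩
  · by_cases h : prob μ (pastEvent i a x lam) = 0
    · simp only [E', ω', if_pos h]
      exact ⟨vacuum_mem_Q, hpk⟩
    · simp only [E', ω', if_neg h]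
      exact ⟨hμ.quantum i a x lam h, hμ.max_peak i a x lam h⟩
  · by_cases h : prob μ (pastEvent i a x lam) = 0
    · simp [E', if_pos h]
    · simp only [E', if_neg h]
      -- Every input has positive probability, so both output probabilities are defined; their
      -- nonnegativity is `|E| ≤ 1`.
      have h2 : prob μ ({o | o.2.1 i = x₀} ∩ pastEvent i a x lam) ≠ 0 := by
        rw [hin i a x lam x₀ h]; exact mul_ne_zero (hp x₀).ne' h
      have ht := hμ.output i a x lam x₀ h2 true
      have hf := hμ.output i a x lam x₀ h2 false
      have ht0 := condProb_nonneg μ {o | o.1 i = true} ({o | o.2.1 i = x₀} ∩ pastEvent i a x lam)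
      have hf0 := condProb_nonneg μ {o | o.1 i = false}
        ({o | o.2.1 i = x₀} ∩ pastEvent i a x lam)
      rw [ht] at ht0
      rw [hf] at hf0
      simp only [sgn, if_true, Bool.false_eq_true, if_false] at ht0 hf0
      rw [abs_le]; constructor <;> linarith
  · have hstep : ∀ i : Fin n, prob μ (prefixEvent (i + 1) o) = prob μ (prefixEvent i o)
        * (p (o.2.1 i)
          * outProb (E' i (past i o.1) (past i o.2.1) o.2.2 (o.2.1 i)) (o.1 i)) := fun i => by
      rw [prefixEvent_succ, ← pastEvent_eq_prefixEvent]
      set T := pastEvent i (past i o.1) (past i o.2.1) o.2.2 with hT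
      by_cases h : prob μ T = 0
      · rw [h, zero_mul]
        refine le_antisymm (h ▸ prob_mono μ ?_) (prob_nonneg _ _)
        exact Set.inter_subset_right.trans Set.inter_subset_right
      · have h2 := hin i _ _ _ (o.2.1 i) h
        have h3 : prob μ ({o' | o'.2.1 i = o.2.1 i} ∩ T) ≠ 0 := by
          rw [h2]; exact mul_ne_zero (hp _).ne' h
        rw [prob_inter_eq_condProb_mul μ h3, hμ.output i _ _ _ _ h3, h2]
        simp only [E', outProb, ← hT, if_neg h]
        ring
    have hind : ∀ k (hk : k ≤ n), prob μ (prefixEvent k o) = prob μ {o' | o'.2.2 = o.2.2}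
        * ∏ j : Fin k, (p (o.2.1 (j.castLE hk))
          * outProb (E' (j.castLE hk) (past (j.castLE hk) o.1) (past (j.castLE hk) o.2.1) o.2.2
              (o.2.1 (j.castLE hk))) (o.1 (j.castLE hk))) := by
      intro k
      induction k with
      | zero => intro hk; simp [prefixEvent]
      | succ k ih =>
        intro hk
        rw [Fin.prod_univ_castSucc, ← mul_assoc]
        exact (hstep ⟨k, hk⟩).trans (congrArg (· * _) (ih (Nat.le_of_succ_le hk)))
    have h := hind n le_rfl
    have hone : prefixEvent n o = {o} := by
      ext o'
      simp only [prefixEvent, Set.mem_ofPred_eq, Set.mem_singleton_iff, Fin.is_lt, forall_const]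
      constructor
      · rintro ⟨h1, h2⟩
        exact Prod.ext (funext fun j => (h1 j).1) (Prod.ext (funext fun j => (h1 j).2) h2)
      · rintro rfl
        exact ⟨fun _ => ⟨rfl, rfl⟩, rfl⟩
    rw [hone, prob_singleton] at h
    rw [h, outputProb, mul_assoc, ← Finset.prod_mul_distrib]
    rfl
  · have h : prob μ (pastEvent i (past i o.1) (past i o.2.1) o.2.2) ≠ 0 := by
      have h1 : 0 < (μ o).toReal := ENNReal.toReal_pos ho (μ.apply_ne_top o)
      rw [← prob_singleton] at h1
      refine (h1.trans_le (prob_mono μ ?_)).ne'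
      rintro _ rfl
      exact ⟨rfl, rfl, rfl⟩
    simp only [ω', if_neg h]

/-! ### Extraction from sub-normalized distributions -/

theorem withSeed_apply {Ω : Type*} (μ : PMF Ω) (l : ℕ) (o : Ω) (s : Bits l) :
    ((withSeed μ l) (o, s)).toReal = (μ o).toReal * unifMass (Bits l) := by
  classical
  have h : withSeed μ l (o, s) = μ o * (Fintype.card (Bits l) : ENNReal)⁻¹ := by
    rw [withSeed, PMF.bind_apply, tsum_eq_single o]
    · rw [PMF.map_apply, tsum_eq_single s]
      · simp
      · intro s' hs'
        rw [if_neg]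
        exact fun h => hs' (Prod.ext_iff.1 h).2.symm
    · intro o' ho'
      rw [PMF.map_apply, ENNReal.tsum_eq_zero.2, mul_zero]
      intro s'
      rw [if_neg]
      exact fun h => ho' (Prod.ext_iff.1 h).1.symm
  rw [h, ENNReal.toReal_mul, ENNReal.toReal_inv, ENNReal.toReal_natCast, unifMass, one_div]

theorem prob_withSeed_fst {Ω : Type*} (μ : PMF Ω) (l : ℕ) (S : Set Ω) :
    prob (withSeed μ l) {q | q.1 ∈ S} = prob μ S := by
  have h : (withSeed μ l).map Prod.fst = μ := by
    rw [withSeed, PMF.map_bind]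
    simp only [PMF.map_comp]
    conv_rhs => rw [← PMF.bind_pure μ]
    congr 1
    funext o
    exact PMF.map_const _ _
  conv_rhs => rw [prob, ← h, PMF.toOuterMeasure_map_apply]
  rfl

section Extractor

variable {n l m : ℕ} (Ext : Bits n → Bits l → Bits m)

/-- Twice the distance of the extractor output for the source weights `w` from the uniform
weights of the same mass. -/
noncomputable def extDist (w : Bits n → ℝ) : ℝ :=
  ∑ k, ∑ s, |∑ a, {a | Ext a s = k}.indicator w a * unifMass (Bits l)
    - unifMass (Bits m × Bits l) * ∑ a, w a|

theorem extDist_add_le (v w : Bits n → ℝ) :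
    extDist Ext (v + w) ≤ extDist Ext v + extDist Ext w := by
  simp only [extDist, ← Finset.sum_add_distrib]
  refine Finset.sum_le_sum fun k _ => Finset.sum_le_sum fun s _ => ?_
  refine le_trans (le_of_eq ?_) (abs_add_le _ _)
  congr 1
  simp only [Set.indicator_add', Pi.add_apply, add_mul, Finset.sum_add_distrib, mul_add]
  ring

theorem extDist_smul {c : ℝ} (hc : 0 ≤ c) (w : Bits n → ℝ) :
    extDist Ext (fun a => c * w a) = c * extDist Ext w := by
  simp only [extDist, Finset.mul_sum]
  refine Finset.sum_congr rfl fun k _ => Finset.sum_congr rfl fun s _ => ?_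
  rw [← abs_of_nonneg hc, ← abs_mul, abs_of_nonneg hc, mul_sub, Finset.mul_sum, Finset.mul_sum]
  congr 2
  · refine Finset.sum_congr rfl fun a _ => ?_
    by_cases h : Ext a s = k <;> simp [h]; ring
  · exact Finset.sum_congr rfl fun a _ => by ring

theorem card_mul_unifMass (α : Type*) [Fintype α] [Nonempty α] :
    (Fintype.card α : ℝ) * unifMass α = 1 := by
  rw [unifMass, mul_one_div_cancel]
  exact_mod_cast Fintype.card_ne_zero

theorem unifMass_nonneg (α : Type*) [Fintype α] : 0 ≤ unifMass α := by
  rw [unifMass]; positivity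

/-- Both families of weights being compared are nonnegative with total mass `∑ a, w a`. -/
theorem extDist_le {w : Bits n → ℝ} (hw : ∀ a, 0 ≤ w a) : extDist Ext w ≤ 2 * ∑ a, w a := by
  classical
  have h0 : 0 ≤ ∑ a, w a := Finset.sum_nonneg fun a _ => hw a
  have hu := unifMass_nonneg (Bits l)
  have hu2 := unifMass_nonneg (Bits m × Bits l)
  calc extDist Ext w
      ≤ ∑ k, ∑ s, (∑ a, {a | Ext a s = k}.indicator w a * unifMass (Bits l)
          + unifMass (Bits m × Bits l) * ∑ a, w a) := by
        refine Finset.sum_le_sum fun k _ => Finset.sum_le_sum fun s _ => ?_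
        have h1 : 0 ≤ ∑ a, {a | Ext a s = k}.indicator w a * unifMass (Bits l) :=
          Finset.sum_nonneg fun a _ => mul_nonneg (Set.indicator_nonneg (fun a _ => hw a) a) hu
        have h2 := mul_nonneg hu2 h0
        rw [abs_le]; constructor <;> linarith
    _ = 2 * ∑ a, w a := by
        simp only [Finset.sum_add_distrib]
        have h1 : ∑ k, ∑ s, ∑ a, {a | Ext a s = k}.indicator w a * unifMass (Bits l)
            = ∑ a, w a := by
          rw [Finset.sum_comm]
          calc _ = ∑ s : Bits l, ∑ a, w a * unifMass (Bits l) := by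
                refine Finset.sum_congr rfl fun s _ => ?_
                rw [Finset.sum_comm]
                refine Finset.sum_congr rfl fun a _ => ?_
                rw [← Finset.sum_mul]
                congr 1
                simp [Set.indicator_apply]
            _ = _ := by
                rw [Finset.sum_const, ← Finset.sum_mul, Finset.card_univ, nsmul_eq_mul,
                  mul_left_comm, card_mul_unifMass, mul_one]
        have h2 : ∑ _k : Bits m, ∑ _s : Bits l, unifMass (Bits m × Bits l) * ∑ a, w a
            = ∑ a, w a := by
          rw [← Fintype.sum_prod_type' (fun (_ : Bits m) (_ : Bits l) =>
            unifMass (Bits m × Bits l) * ∑ a, w a), Finset.sum_const, Finset.card_univ,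
            nsmul_eq_mul, ← mul_assoc, card_mul_unifMass, one_mul]
        rw [h1, h2]; ring

variable {Ext}

theorem IsStrongExtractor.extDist_le {k ε : ℝ} (hExt : IsStrongExtractor Ext k ε)
    {w : Bits n → ℝ} (hw : ∀ a, 0 ≤ w a) (hk : ∀ a, w a ≤ (2 : ℝ) ^ (-k) * ∑ a', w a') :
    extDist Ext w ≤ 2 * (ε * ∑ a, w a) := by
  have h0 : 0 ≤ ∑ a, w a := Finset.sum_nonneg fun a _ => hw a
  rcases h0.eq_or_lt with h0 | h0
  · have := EnergyQRNG.extDist_le Ext hw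
    rw [← h0] at this ⊢
    simpa using this
  set N := ∑ a, w a with hN
  let ν : PMF (Bits n) := PMF.ofFintype (fun a => ENNReal.ofReal (N⁻¹ * w a)) <| by
    rw [← ENNReal.ofReal_sum_of_nonneg fun a _ => mul_nonneg (inv_nonneg.2 h0.le) (hw a),
      ← Finset.mul_sum, ← hN, inv_mul_cancel₀ h0.ne', ENNReal.ofReal_one]
  have hν : ∀ a, (ν a).toReal = N⁻¹ * w a := fun a => by
    rw [PMF.ofFintype_apply, ENNReal.toReal_ofReal (mul_nonneg (inv_nonneg.2 h0.le) (hw a))]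
  have h := hExt ν fun a => by
    rw [prob_singleton, hν, inv_mul_le_iff₀ h0, mul_comm]
    exact hk a
  have hTV : TV (fun z : Bits m × Bits l =>
      prob (withSeed ν l) {q | Ext q.1 q.2 = z.1 ∧ q.2 = z.2})
      (fun _ => unifMass (Bits m × Bits l)) = 1 / 2 * extDist Ext (fun a => N⁻¹ * w a) := by
    rw [TV, tsum_fintype, Fintype.sum_prod_type, extDist]
    congr 1
    refine Finset.sum_congr rfl fun k _ => Finset.sum_congr rfl fun s _ => ?_
    rw [← Finset.mul_sum, ← hN, inv_mul_cancel₀ h0.ne', mul_one]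
    congr 2
    rw [prob_eq_sum_of_subset_range (g := fun a : Bits n => (a, s)) _
      (fun a b h => (Prod.ext_iff.1 h).1)]
    · refine Finset.sum_congr rfl fun a _ => ?_
      by_cases ha : Ext a s = k
      · simp [ha, withSeed_apply, hν]
      · simp [ha]
    · rintro ⟨a, s'⟩ ⟨_, h2⟩
      exact ⟨a, Prod.ext rfl h2.symm⟩
  rw [hTV, extDist_smul Ext (inv_nonneg.2 h0.le)] at h
  have h2 : N⁻¹ * extDist Ext w ≤ 2 * ε := by linarith
  rw [inv_mul_le_iff₀ h0] at h2
  linarith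

/-- Extraction from a distribution whose part `v` has small conditional weights, relative to the
mass `c` of the condition. -/
theorem IsStrongExtractor.extDist_le_of_part {k ε δ c : ℝ} (hExt : IsStrongExtractor Ext k ε)
    (hε : 0 ≤ ε) (hδ : 0 ≤ δ) (hc : 0 ≤ c) {v w : Bits n → ℝ} (hv : ∀ a, 0 ≤ v a)
    (hvw : ∀ a, v a ≤ w a) (hk : ∀ a, v a ≤ (2 : ℝ) ^ (-k) * δ * c) :
    extDist Ext w ≤ 2 * (ε * ∑ a, w a + (∑ a, w a - ∑ a, v a) + δ * c) := by
  have hsum : ∑ a, v a ≤ ∑ a, w a := Finset.sum_le_sum fun a _ => hvw a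
  have h0 : 0 ≤ ∑ a, v a := Finset.sum_nonneg fun a _ => hv a
  have hδc := mul_nonneg hδ hc
  -- A heavy `v` has min-entropy at least `k` once normalised, and the rest `w - v` is bounded
  -- trivially. A light `v` makes the trivial bound for `w` sufficient.
  by_cases hlarge : δ * c ≤ ∑ a, v a
  · have h1 := extDist_add_le Ext v (w - v)
    rw [add_sub_cancel] at h1
    have h2 := hExt.extDist_le hv fun a => (hk a).trans (by
      rw [mul_assoc]
      exact mul_le_mul_of_nonneg_left hlarge (by positivity))
    have h3 := EnergyQRNG.extDist_le Ext (w := w - v) fun a => sub_nonneg.2 (hvw a)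
    simp only [Pi.sub_apply, Finset.sum_sub_distrib] at h3
    have h4 := mul_le_mul_of_nonneg_left hsum hε
    linarith
  · have h1 := EnergyQRNG.extDist_le Ext fun a => (hv a).trans (hvw a)
    have h4 := mul_nonneg hε (h0.trans hsum)
    linarith

end Extractor

namespace Args

variable {P : Args} {L : Type*}

/-- The factor `κ` cancels the conditioning, leaving, for each `(Xⁿ, Λ)`, an `extDist` of weights
restricted to `Pass`. -/
theorem κ_mul_TV (μ : PMF (Run P.n L)) (hκ : 0 < P.κ μ) :
    P.κ μ * TV (P.realMass μ) (P.idealMass μ) = 1 / 2 * ∑' z : Bits P.σ × Bits P.l ×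
      (Fin P.n → Fin 2) × L, |∑ a, {a | P.ext a z.2.1 = z.1}.indicator
          (fun a => (P.pass L).indicator (fun o => (μ o).toReal) (a, z.2.2)) a
            * unifMass (Bits P.l)
        - unifMass (Bits P.σ × Bits P.l)
          * ∑ a, (P.pass L).indicator (fun o => (μ o).toReal) (a, z.2.2)| := by
  rw [TV, mul_left_comm, ← tsum_mul_left]
  congr 1
  refine tsum_congr fun z => ?_
  obtain ⟨k, s, y⟩ := z
  rw [← abs_of_pos hκ, ← abs_mul, mul_sub]
  congr 2
  · rw [realMass, condProb, prob_withSeed_fst, κ, mul_div_cancel₀ _ (show prob μ (P.pass L) ≠ 0 from hκ.ne'),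
      prob_eq_sum_of_subset_range (g := fun a : Bits P.n => ((a, y), s)) _
        (fun a b h => (Prod.ext_iff.1 (Prod.ext_iff.1 h).1).1)]
    · refine Finset.sum_congr rfl fun a _ => ?_
      by_cases ha : P.ext a s = k <;> by_cases hp : (a, y) ∈ P.pass L <;>
        simp [ha, hp, withSeed_apply]
    · rintro ⟨⟨a, y'⟩, s'⟩ ⟨⟨_, h2, h3⟩, _⟩
      exact ⟨a, Prod.ext (Prod.ext rfl h3.symm) h2.symm⟩
  · rw [idealMass, condProb, κ, mul_left_comm, mul_div_cancel₀ _ (show prob μ (P.pass L) ≠ 0 from hκ.ne'),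
      prob_eq_sum_of_subset_range (g := fun a : Bits P.n => (a, y)) _
        (fun a b h => (Prod.ext_iff.1 h).1)]
    · congr 1
      refine Finset.sum_congr rfl fun a _ => ?_
      by_cases hp : (a, y) ∈ P.pass L <;> simp [hp]
    · rintro ⟨a, y'⟩ ⟨h2, _⟩
      exact ⟨a, Prod.ext rfl h2.symm⟩

/-- Apply `extDist_le_of_part` for each `(x, lam)`, with `c` its probability and `v` the weights on
`Pass ∩ good`. Summed up, `w` gives `κ`, `w - v` at most the probability of `goodᶜ`, and `c` gives
1. -/
theorem Valid.κ_mul_TV_le (hP : P.Valid) (μ : PMF (Run P.n L)) (hκ : 0 < P.κ μ)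
    (good : Set (Run P.n L))
    (hgood : ∀ o ∈ P.pass L ∩ good,
      (μ o).toReal ≤ (2 : ℝ) ^ (-P.σh) * P.εm * ∑ a, (μ (a, o.2)).toReal) :
    P.κ μ * TV (P.realMass μ) (P.idealMass μ)
      ≤ P.εExt * P.κ μ + prob μ goodᶜ + P.εm := by
  have hf : ∀ o, 0 ≤ (μ o).toReal := fun o => ENNReal.toReal_nonneg
  have hsplit : P.κ μ - prob μ (P.pass L ∩ good) ≤ prob μ goodᶜ := by
    have h : P.pass L ⊆ (P.pass L ∩ good) ∪ goodᶜ := fun o ho => by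
      by_cases h : o ∈ good
      · exact .inl ⟨ho, h⟩
      · exact .inr h
    have := (prob_mono μ h).trans (prob_union_le μ _ _)
    rw [κ]; linarith
  have hsum := ((((hasSum_prob_fiber μ (P.pass L)).mul_left P.εExt).add
    ((hasSum_prob_fiber μ (P.pass L)).sub (hasSum_prob_fiber μ (P.pass L ∩ good)))).add
    ((hasSum_prob_fiber μ Set.univ).mul_left P.εm)).mul_left 2
  rw [κ_mul_TV μ hκ]
  refine (mul_le_mul_of_nonneg_left (tsum_le_of_hasSum_fiber (fun z => abs_nonneg _)
    (fun lam => ?_) hsum) (by norm_num)).trans ?_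
  swap
  · rw [prob_univ, mul_one]
    rw [κ] at hsplit ⊢
    linarith
  · simp only [Finset.mul_sum (s := (Finset.univ : Finset (Fin P.n → Fin 2))),
      ← Finset.sum_sub_distrib (s := (Finset.univ : Finset (Fin P.n → Fin 2))),
      ← Finset.sum_add_distrib (s := (Finset.univ : Finset (Fin P.n → Fin 2)))]
    refine Finset.sum_le_sum fun x _ => ?_
    simp only [Set.indicator_univ]
    refine hP.extractor.extDist_le_of_part hP.εExt_pos.le hP.εm_pos.le
      (Finset.sum_nonneg fun a _ => hf _) (fun a => Set.indicator_nonneg (fun o _ => hf o) _)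
      (fun a => Set.indicator_le_indicator_of_subset Set.inter_subset_left hf _) fun a => ?_
    by_cases h : (a, x, lam) ∈ P.pass L ∩ good
    · rw [Set.indicator_of_mem h]
      exact hgood _ h
    · rw [Set.indicator_of_notMem h]
      have := hP.εm_pos
      exact mul_nonneg (by positivity) (Finset.sum_nonneg fun a _ => hf _)

end Args

/-! ### Min-entropy of the outputs -/

/-- The sum of the scores of all rounds. -/
noncomputable def Args.totalScore {L : Type*} (P : Args) (E ω : RoundFun P.n L)
    (o : Run P.n L) : ℝ :=
  ∑ i, P.score (E i (past i o.1) (past i o.2.1) o.2.2) (ω i (past i o.1) (past i o.2.1) o.2.2)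
    (o.1 i, o.2.1 i)

/-- Bernstein's bound is in base `e` while `t` uses binary logarithms; `log 2 < 1` makes the
mismatch favourable. -/
theorem exp_neg_logb_le {ε : ℝ} (hε : 0 < ε) (hε1 : ε ≤ 1) :
    Real.exp (-Real.logb 2 (1 / ε)) ≤ ε := by
  conv_rhs => rw [← Real.exp_log hε]
  rw [Real.exp_le_exp, one_div, Real.logb_inv, neg_neg, Real.logb]
  have hl : 0 < Real.log 2 := Real.log_pos one_lt_two
  rw [div_le_iff₀ hl]
  nlinarith [Real.log_nonpos hε.le hε1, Real.log_two_lt_d9]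

section Device

variable {P : Args} {L : Type*} {μ : PMF (Run P.n L)} {E ω : RoundFun P.n L}

theorem Args.Valid.prob_totalScore_gt_le (hP : P.Valid) (ht : 0 ≤ P.t)
    (hQ : ∀ i a x lam, (E i a x lam, ω i a x lam) ∈ Qpk P.ωpk)
    (hE : ∀ i a x lam x₀, |E i a x lam x₀| ≤ 1)
    (hfac : ∀ o, (μ o).toReal = prob μ {o' | o'.2.2 = o.2.2} * (∏ i, P.p (o.2.1 i))
      * outputProb E o) :
    prob μ {o | P.n * P.t < P.totalScore E ω o} ≤ P.εt := by
  rcases le_total 1 P.εt with h1 | h1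
  · exact (prob_le_one _ _).trans h1
  have hn : (0 : ℝ) < P.n := by exact_mod_cast hP.n_pos
  have hlog : 0 ≤ Real.logb 2 (1 / P.εt) :=
    Real.logb_nonneg one_lt_two ((one_le_div hP.εt_pos).2 h1)
  have hexp : Real.exp (-(P.n * (Real.logb 2 (1 / P.εt) / P.n))) ≤ P.εt := by
    rw [mul_div_cancel₀ _ hn.ne']
    exact exp_neg_logb_le hP.εt_pos h1
  have hmarg : ∀ lam, prob μ {o | o.2.2 = lam}
      = ∑ x, ∑ a, Set.univ.indicator (fun o => (μ o).toReal) (a, x, lam) := fun lam => by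
    rw [prob_eq_sum_of_subset_range
      (g := fun z : (Fin P.n → Fin 2) × Bits P.n => ((z.2, z.1, lam) : Run P.n L)) μ
      (fun z z' h => Prod.ext (Prod.ext_iff.1 (Prod.ext_iff.1 h).2).1 (Prod.ext_iff.1 h).1),
      Fintype.sum_prod_type]
    · simp
    · rintro ⟨a, x, lam'⟩ rfl
      exact ⟨(x, a), rfl⟩
  have htot := (hasSum_prob_fiber μ Set.univ).mul_right P.εt
  rw [prob_univ, one_mul] at htot
  refine hasSum_le (fun lam => ?_) (hasSum_prob_fiber μ _) htot
  rw [← hmarg lam]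
  -- For fixed `lam` the pairs `(A_i, X_i)` form one adapted sequence; the resulting bound is then
  -- averaged over `Λ`.
  have hround := sum_prod_past_indicator_le (α := Bool × Fin 2) hP.n_pos
    (fun i v c => P.p c.2 * outProb (E i (fun j => (v j).1) (fun j => (v j).2) lam c.2) c.1)
    (fun i v c => P.score (E i (fun j => (v j).1) (fun j => (v j).2) lam)
      (ω i (fun j => (v j).1) (fun j => (v j).2) lam) c)
    (Args.V_pos (P := P)) (div_nonneg hlog hn.le) ht
    (fun i v c => mul_nonneg (hP.p_pos _).le (outProb_nonneg (hE _ _ _ _ _) _))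
    (fun i v => Args.sum_weight hP.p_sum _)
    (fun i v c => hP.score_le (hQ _ _ _ _) (hE _ _ _ _) c)
    (fun i v => hP.sum_score_nonpos (hQ _ _ _ _))
    (fun i v => hP.sum_score_sq_le (hQ _ _ _ _) (hE _ _ _ _))
  refine le_trans (le_of_eq ?_)
    (mul_le_mul_of_nonneg_left (hround.trans hexp) (prob_nonneg μ {o | o.2.2 = lam}))
  rw [Finset.sum_comm, ← Fintype.sum_prod_type',
    ← (Equiv.arrowProdEquivProdArrow (Fin P.n) (fun _ => Bool) fun _ => Fin 2).sum_comp,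
    Finset.mul_sum]
  refine Finset.sum_congr rfl fun u _ => ?_
  let o : Run P.n L := (fun i => (u i).1, fun i => (u i).2, lam)
  change Set.indicator _ _ o = _
  by_cases ho : P.n * P.t < P.totalScore E ω o
  · rw [Set.indicator_of_mem (by exact ho), Set.indicator_of_mem (by exact ho), hfac o,
      outputProb, mul_assoc, ← Finset.prod_mul_distrib]
    rfl
  · rw [Set.indicator_of_notMem (by exact ho), Set.indicator_of_notMem (by exact ho), mul_zero]

/-- The input factors do not depend on the outputs, and for fixed inputs the output factors sum to 1
round by round. -/
theorem mass_eq_outputProb_mul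
    (hfac : ∀ o, (μ o).toReal = prob μ {o' | o'.2.2 = o.2.2} * (∏ i, P.p (o.2.1 i))
      * outputProb E o) (o : Run P.n L) :
    (μ o).toReal = outputProb E o * ∑ a, (μ (a, o.2)).toReal := by
  have hone : ∑ a : Bits P.n, outputProb E (a, o.2) = 1 :=
    sum_prod_past_eq_one
      (fun i v c => outProb (E i v (past i o.2.1) o.2.2 (o.2.1 i)) c) fun i v => sum_outProb _
  have hsum : ∑ a, (μ (a, o.2)).toReal = prob μ {o' | o'.2.2 = o.2.2} * ∏ i, P.p (o.2.1 i) := by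
    simp only [hfac (_, o.2)]
    rw [← Finset.mul_sum, hone, mul_one]
  rw [hsum, hfac o, mul_comm]

theorem Args.Valid.outputProb_le (hP : P.Valid) (hE : ∀ i a x lam x₀, |E i a x lam x₀| ≤ 1)
    {o : Run P.n L} (hpass : o ∈ P.pass L)
    (havg : ∀ x₀, (1 / (P.n : ℝ)) * ∑ i, ω i (past i o.1) (past i o.2.1) o.2.2 x₀ ≤ P.ωavg x₀)
    (hscore : P.totalScore E ω o ≤ P.n * P.t) :
    outputProb E o ≤ (2 : ℝ) ^ (-P.σh) * P.εm := by
  have hn : (0 : ℝ) < P.n := by exact_mod_cast hP.n_pos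
  -- The term `log (1 / ε_m)` in `σ_h` is the entropy set aside for normalisation.
  have hσ : (2 : ℝ) ^ (-P.σh) * P.εm = (2 : ℝ) ^ (-(P.n * (P.r - P.t))) := by
    have : -P.σh = -(P.n * (P.r - P.t)) + Real.logb 2 (1 / P.εm) := by
      rw [Args.σh, Args.t]; field_simp; ring
    rw [this, Real.rpow_add two_pos, Real.rpow_logb two_pos (by norm_num)
      (one_div_pos.2 hP.εm_pos), mul_assoc, one_div_mul_cancel hP.εm_pos.ne', mul_one]
  rw [hσ]
  have hq : ∀ i, 0 ≤ outProb (E i (past i o.1) (past i o.2.1) o.2.2 (o.2.1 i)) (o.1 i) :=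
    fun i => outProb_nonneg (hE _ _ _ _ _) _
  rcases (Finset.prod_nonneg fun i (_ : i ∈ Finset.univ) => hq i).eq_or_lt with h0 | h0
  · rw [outputProb, ← h0]; positivity
  rw [outputProb, ← Real.logb_le_iff_le_rpow one_lt_two h0,
    Real.logb_prod _ _ fun i hi => Finset.prod_ne_zero_iff.1 h0.ne' i hi]
  have hpass' : P.n * P.r ≤ ∑ i, P.ξ (o.1 i) (o.2.1 i) + P.n * ∑ x, P.γ x * P.ωavg x := by
    have h : P.r ≤ (1 / (P.n : ℝ)) * ∑ i, P.ξ (o.1 i) (o.2.1 i) + ∑ x, P.γ x * P.ωavg x := hpass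
    have := mul_le_mul_of_nonneg_left h hn.le
    rwa [mul_add, ← mul_assoc, mul_one_div_cancel hn.ne', one_mul] at this
  -- As `γ ≤ 0`, the upper bound on the average energies becomes a lower bound on the energy terms.
  have henergy : P.n * ∑ x, P.γ x * P.ωavg x
      ≤ ∑ i, ∑ x, P.γ x * ω i (past i o.1) (past i o.2.1) o.2.2 x := by
    rw [Finset.sum_comm, Finset.mul_sum]
    refine Finset.sum_le_sum fun x _ => ?_
    rw [← Finset.mul_sum, mul_left_comm]
    refine mul_le_mul_of_nonpos_left ?_ (hP.tradeoff.1 x)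
    have := havg x
    rwa [one_div, inv_mul_le_iff₀ hn] at this
  have hsplit : P.totalScore E ω o = ∑ i, P.ξ (o.1 i) (o.2.1 i)
      + ∑ i, ∑ x, P.γ x * ω i (past i o.1) (past i o.2.1) o.2.2 x
      + ∑ i, Real.logb 2
          (outProb (E i (past i o.1) (past i o.2.1) o.2.2 (o.2.1 i)) (o.1 i)) := by
    rw [← Finset.sum_add_distrib, ← Finset.sum_add_distrib]
    rfl
  linarith

theorem Args.Valid.soundness (hP : P.Valid) (ht : 0 ≤ P.t)
    (hμ : DeviceAssumptions μ E ω P.p P.ωpk P.ωavg P.εω) (hκ : 0 < P.κ μ) :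
    P.κ μ * TV (P.realMass μ) (P.idealMass μ)
      ≤ P.εExt * P.κ μ + (P.εω + P.εt + P.εm) := by
  obtain ⟨E', ω', hQ, hE, hfac, hω⟩ :=
    exists_regular_device hμ hP.p_pos (hP.avg_nonneg.trans hP.avg_le_pk)
  let avg : Set (Run P.n L) := {o | ∀ x₀,
    (1 / (P.n : ℝ)) * ∑ i, ω i (past i o.1) (past i o.2.1) o.2.2 x₀ ≤ P.ωavg x₀}
  let tail : Set (Run P.n L) := {o | P.n * P.t < P.totalScore E' ω' o}
  have havg : prob μ avgᶜ ≤ P.εω := by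
    rw [prob_compl]; linarith [hμ.max_avg]
  have htail : prob μ tail ≤ P.εt := hP.prob_totalScore_gt_le ht hQ hE hfac
  have hbad : prob μ (avg ∩ tailᶜ)ᶜ ≤ P.εω + P.εt := by
    rw [Set.compl_inter, compl_compl]
    exact (prob_union_le μ _ _).trans (add_le_add havg htail)
  have h := hP.κ_mul_TV_le μ hκ (avg ∩ tailᶜ) fun o ho => by
    have hsum : 0 ≤ ∑ a, (μ (a, o.2)).toReal := Finset.sum_nonneg fun a _ => ENNReal.toReal_nonneg
    -- The modified energies agree with the original ones only along runs of positive probability;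
    -- null runs satisfy the bound trivially.
    by_cases h0 : μ o = 0
    · have := hP.εm_pos
      rw [h0, ENNReal.toReal_zero]
      positivity
    · rw [mass_eq_outputProb_mul hfac o]
      refine mul_le_mul_of_nonneg_right (hP.outputProb_le (ω := ω') hE ho.1 ?_ ?_) hsum
      · simp only [hω o h0]
        exact ho.2.1
      · exact not_lt.1 ho.2.2
  linarith

end Device

end EnergyQRNG

/-! ### Soundness of the protocol -/

theorem theorem5 {L : Type*} (P : EnergyQRNG.Args) (hP : P.Valid) (ht : 0 ≤ P.t)
    (μ : PMF (EnergyQRNG.Run P.n L)) (E ω : EnergyQRNG.RoundFun P.n L)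
    (hμ : EnergyQRNG.DeviceAssumptions μ E ω P.p P.ωpk P.ωavg P.εω) :
    (0 < P.κ μ →
      EnergyQRNG.TV (P.realMass μ) (P.idealMass μ)
          ≤ P.εExt + (P.εω + P.εt + P.εm) / P.κ μ ∧
        P.εExt + (P.εω + P.εt + P.εm) / P.κ μ ≤ P.ε / P.κ μ) ∧
    P.κ μ * EnergyQRNG.TV (P.realMass μ) (P.idealMass μ) ≤ P.ε := by
  have hκ1 : P.κ μ ≤ 1 := EnergyQRNG.prob_le_one μ _
  have hExt := hP.εExt_pos
  have hεκ : P.εExt * P.κ μ ≤ P.εExt := mul_le_of_le_one_right hExt.le hκ1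
  refine ⟨fun hκ => ⟨?_, ?_⟩, ?_⟩
  · have h := hP.soundness ht hμ hκ
    rw [add_div' _ _ _ hκ.ne', le_div_iff₀ hκ, mul_comm]
    exact h
  · rw [add_div' _ _ _ hκ.ne']
    refine div_le_div_of_nonneg_right ?_ hκ.le
    rw [EnergyQRNG.Args.ε]
    linarith
  · rcases (EnergyQRNG.prob_nonneg μ (P.pass L)).eq_or_lt with h0 | hκ
    · rw [EnergyQRNG.Args.κ, ← h0, zero_mul, EnergyQRNG.Args.ε]
      linarith [hP.εt_pos, hP.εm_pos, hP.εω_nonneg]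
    · refine (hP.soundness ht hμ hκ).trans ?_
      rw [EnergyQRNG.Args.ε]
      linarith
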